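/- **Conventions.** Let $k$ be a field of characteristic $0$; vector spaces are $\mathbb Z/2$-graded over $k$, $(V,d_V)$ is a dg vector space (possibly infinite-dimensional), $\Pi V$ is its parity reversion, with $d_{\Pi V}\Pi=-\Pi d_V$, and all formulas are subject to the Koszul sign rule. A *formal cdga* $A$ is obtained by adjoining a unit to an inverse limit $A_+=\varprojlim A_{+,i}$, over a directed poset, of finite-dimensional nilpotent supercommutative dg algebras, and $A_+\otimes E:=\varprojlim A_{+,i}\otimes E$. Operations on a space extend $A$-multilinearly to its tensor product with $A_+$. An *$A$-linear $L_\infty$ structure* on $V$ is a family $m=(m_n)_{n\ge1}$ of odd graded symmetric multilinear maps $m_n:(\Pi V)^{\otimes n}\to A_+\otimes\Pi V$ such that for all $n\ge 1$ $$d(m_n)+\sum_{j=1}^{n}\ \sum_{\sigma\in \mathrm{Sh}(j,n-j)}\sigma\,(m_{n-j+1}\circ_1 m_j)=0 ,$$ where $d(m_n)$ is the differential of $A_+\otimes\operatorname{Hom}((\Pi V)^{\otimes n},\Pi V)$. An *$A$-linear $A_\infty$ structure* is a family of odd maps $m_n$, not necessarily symmetric, with $d(m_n)+\sum_{j=1}^{n}\sum_{i=1}^{n-j+1}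 m_{n-j+1}\circ_i m_j=0$ for all $n\ge1$. The set $\mathrm{MC}((V,m),A)$ consists of the even $\xi\in A_+\otimes\Pi V$ with $d\xi+\sum_{n\ge1}\frac1{n!}m_n(\xi,\dots,\xi)=0$ in the $L_\infty$ case, and with $d\xi+\sum_{n\ge1}m_n(\xi,\dots,\xi)=0$ in the $A_\infty$ case. The same $L_\infty$ formula defines $\mathrm{MC}(L,A)$ for an $L_\infty$ algebra $L$ over $k$. If $V$ carries a scalar product (an even, graded symmetric, non-degenerate bilinear form $\langle\ ,\ \rangle$ compatible with $d_V$), put $\omega(\Pi x,\Pi y)=(-1)^{|x|}\langle x,y\rangle$; a family $m$ is *cyclic* if every $(x_0,\dots,x_n)\mapsto\omega(m_n(x_0,\dots,x_{n-1}),x_n)$ is invariant under cyclic permutations. Let $\mathfrak a(V)=\prod_{n\ge1}\operatorname{Hom}((\Pi V)^{\otimes n},\Pi V)$ be the dg Lie algebra of continuous derivations of $\hat T\Pi V^*$ vanishing at zero, and let $\mathfrak c(V)=\prod_{n\ge1}\operatorname{Hom}(S^n\Pi V,\Pi V)$ be that of continuous derivations of $\hat S\Pi V^*$ vanishing at zero,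 with differential $[d_{\Pi V},-]$ and with bracket the graded commutator of the composition $g\star h=\sum g\circ_i h$, respectively $g\star h=\sum_{\sigma}\sigma(g\circ_1h)$ with $\sigma$ running over shuffles. Let $\mathfrak{as}(V)$ and $\mathfrak{cs}(V)$ be the dg Lie subalgebras of symplectic (i.e. cyclic) elements, for $V$ with a scalar product. For $\mathfrak h$ one of these, with $\rho:\mathfrak h\to\prod_{n}\operatorname{Hom}(S^n\Pi V,\Pi V)$ the inclusion in the case of $\mathfrak c(V)$, $\mathfrak{cs}(V)$ and the symmetrization $g_n\mapsto\sum_{\sigma\in S_n}\sigma g_n$ in the case of $\mathfrak a(V)$, $\mathfrak{as}(V)$, let $\tilde{\mathfrak h}(V)=\mathfrak h\oplus V$ be the $L_\infty$ algebra whose only non-zero structure maps, up to symmetry, are $$m_2(\Pi g,\Pi h)=(-1)^{|g|}\,\Pi[g,h],\qquad m_{n+1}(\Pi g,w_1,\dots,w_n)=\rho(g)_n(w_1,\dots,w_n)$$ for $g,h\in\mathfrak h$, $n\ge1$ and $w_i\in\Pi V$. **Theorem.** Let $A$ be a formal cdga and $V$ a dg vector space, with a scalar product in (2) and (4). Identify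 an element of $A_+\otimes\Pi\tilde{\mathfrak h}(V)$ with a pair $(m,\xi)$ consisting of a family of maps $m_n:(\Pi V)^{\otimes n}\to A_+\otimes\Pi V$ and of $\xi\in A_+\otimes\Pi V$, by sending $a\otimes\Pi g$ to the maps $(x_1,\dots,x_n)\mapsto(-1)^{|a|}a\otimes g_n(x_1,\dots,x_n)$ and $a\otimes w$, for $w\in\Pi V$, to $a\otimes w\in A_+\otimes\Pi V$. Under this identification: 1. $\mathrm{MC}(\tilde{\mathfrak c}(V),A)$ corresponds bijectively to the set of pairs $(m,\xi)$ with $m$ an $A$-linear $L_\infty$ structure on $V$ and $\xi\in\mathrm{MC}((V,m),A)$. 2. $\mathrm{MC}(\widetilde{\mathfrak{cs}}(V),A)$ corresponds bijectively to the set of pairs $(m,\xi)$ with $m$ an $A$-linear cyclic $L_\infty$ structure on $V$ and $\xi\in\mathrm{MC}((V,m),A)$. 3. $\mathrm{MC}(\tilde{\mathfrak a}(V),A)$ corresponds bijectively to the set of pairs $(m,\xi)$ with $m$ an $A$-linear $A_\infty$ structure on $V$ and $\xi\in\mathrm{MC}((V,m),A)$. 4. $\mathrm{MC}(\widetilde{\mathfrak{as}}(V),A)$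 corresponds bijectively to the set of pairs $(m,\xi)$ with $m$ an $A$-linear cyclic $A_\infty$ structure on $V$ and $\xi\in\mathrm{MC}((V,m),A)$. -/

import Mathlib

open scoped TensorProduct
open Finset Filter

namespace MCFields

universe u v w

/-- The sign `(-1)^p` of a parity `p`. -/
def sgn (k : Type*) [Field k] (p : ZMod 2) : k := (-1) ^ p.val

/-! ### Differential `ℤ/2`-graded vector spaces -/

/-- A dg structure (`ℤ/2`-grading and odd differential) on a vector space over a field of
characteristic zero. The grading is recorded by its parity involution `par`, which is `+1` on the
even part and `-1` on the odd part. -/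
structure DGSpace (k V : Type*) [Field k] [AddCommGroup V] [Module k V] where
  par : V →ₗ[k] V
  d : V →ₗ[k] V
  par_par : ∀ x, par (par x) = x
  par_d : ∀ x, par (d x) = -d (par x)
  d_d : ∀ x, d (d x) = 0

namespace DGSpace

variable {k : Type*} [Field k] {V : Type*} [AddCommGroup V] [Module k V]

/-- `x` is homogeneous of parity `p`. -/
def IsHom (S : DGSpace k V) (p : ZMod 2) (x : V) : Prop := S.par x = sgn k p • x

/-- The projection to the part of parity `p`. -/
noncomputable def proj (S : DGSpace k V) (p : ZMod 2) : V →ₗ[k] V :=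
  (2 : k)⁻¹ • (LinearMap.id + sgn k p • S.par)

/-- The parity reversion `ΠV`, on the same underlying vector space: parities are reversed and
`d (Πx) = -Π (d x)`. -/
def shift (S : DGSpace k V) : DGSpace k V where
  par := -S.par
  d := -S.d
  par_par x := by simp [S.par_par]
  par_d x := by simp [S.par_d]
  d_d x := by simp [S.d_d]

/-- The direct sum of two dg vector spaces. -/
def prod {U : Type*} [AddCommGroup U] [Module k U] (S : DGSpace k V) (T : DGSpace k U) :
    DGSpace k (V × U) where
  par := S.par.prodMap T.par
  d := S.d.prodMap T.d
  par_par x := by simp [S.par_par, T.par_par]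
  par_d x := by simp [S.par_d, T.par_d]
  d_d x := by simp [S.d_d, T.d_d]

/-- The tensor product of two dg vector spaces, with the differential `d ⊗ id + id ⊗ d`, where
`(id ⊗ d) (b ⊗ x) = (-1)^|b| b ⊗ d x`. -/
noncomputable def tensor {U : Type*} [AddCommGroup U] [Module k U] (S : DGSpace k V)
    (T : DGSpace k U) : DGSpace k (V ⊗[k] U) where
  par := TensorProduct.map S.par T.par
  d := TensorProduct.map S.d LinearMap.id + TensorProduct.map S.par T.d
  par_par x := by
    induction x using TensorProduct.induction_on with
    | zero => simp
    | tmul a b => simp [S.par_par, T.par_par]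
    | add a b ha hb => simp only [map_add, ha, hb]
  par_d x := by
    induction x using TensorProduct.induction_on with
    | zero => simp
    | tmul a b =>
      simp [S.par_par, S.par_d, T.par_d, TensorProduct.tmul_neg, TensorProduct.neg_tmul]
      abel
    | add a b ha hb => simp only [map_add, ha, hb, neg_add]
  d_d x := by
    induction x using TensorProduct.induction_on with
    | zero => simp
    | tmul a b => simp [S.d_d, T.d_d, S.par_d, TensorProduct.neg_tmul]
    | add a b ha hb => simp only [map_add, ha, hb, add_zero]

end DGSpace

/-! ### Formal cdgas -/

/-- The laws of a unital augmented supercommutative dg algebra with finite-dimensional underlying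
space and nilpotent augmentation ideal; equivalently, the result of adjoining a unit to a
finite-dimensional nilpotent cdga, namely to the kernel of `aug`. -/
structure NilpotentCDGA (k B : Type*) [Field k] [Ring B] [Algebra k B] extends DGSpace k B where
  par_mul : ∀ a b, par (a * b) = par a * par b
  d_mul : ∀ a b, d (a * b) = d a * b + par a * d b
  comm : ∀ p q a b, toDGSpace.IsHom p a → toDGSpace.IsHom q b → a * b = sgn k (p * q) • (b * a)
  aug : B →ₐ[k] k
  aug_par : ∀ a, aug (par a) = aug a
  aug_d : ∀ a, aug (d a) = 0
  finite : Module.Finite k B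
  nilpotent : ∃ N : ℕ, ∀ a : Fin N → B, (∀ j, aug (a j) = 0) → (List.ofFn a).prod = 0

/-- A formal cdga `A`, given as a filtered inverse system of finite-dimensional nilpotent cdgas with
a unit adjoined; `A` is the inverse limit, and `A₊` is the inverse limit of the augmentation
ideals. -/
structure FormalCDGA (k : Type u) [Field k] where
  Idx : Type v
  [preorder : Preorder Idx]
  [directed : IsDirectedOrder Idx]
  [nonempty : Nonempty Idx]
  Alg : Idx → Type w
  [ring : ∀ i, Ring (Alg i)]
  [algebra : ∀ i, Algebra k (Alg i)]
  cdga : ∀ i, NilpotentCDGA k (Alg i)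
  map : ∀ {i j : Idx}, i ≤ j → Alg j →ₐ[k] Alg i
  map_self : ∀ i a, map (le_refl i) a = a
  map_map : ∀ {i j l : Idx} (h : i ≤ j) (h' : j ≤ l) (a : Alg l),
    map h (map h' a) = map (h.trans h') a
  map_par : ∀ {i j : Idx} (h : i ≤ j) (a : Alg j), map h ((cdga j).par a) = (cdga i).par (map h a)
  map_d : ∀ {i j : Idx} (h : i ≤ j) (a : Alg j), map h ((cdga j).d a) = (cdga i).d (map h a)
  map_aug : ∀ {i j : Idx} (h : i ≤ j) (a : Alg j), (cdga i).aug (map h a) = (cdga j).aug a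

attribute [instance] FormalCDGA.preorder FormalCDGA.directed FormalCDGA.nonempty FormalCDGA.ring
  FormalCDGA.algebra

/-- The (completed) tensor product `A₊ ⊗ E = lim (A₊)ᵢ ⊗ E`. As the `(A₊)ᵢ` are finite-dimensional,
tensoring with them commutes with inverse limits, so that this is also the completed tensor product
when `E` is itself an inverse limit of discrete spaces. -/
def FormalCDGA.tensor {k : Type*} [Field k] (A : FormalCDGA k) (E : Type*) [AddCommGroup E]
    [Module k E] : Submodule k (∀ i, A.Alg i ⊗[k] E) where
  carrier := {ξ | (∀ i, LinearMap.rTensor E (A.cdga i).aug.toLinearMap (ξ i) = 0) ∧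
    ∀ (i j : A.Idx) (h : i ≤ j), LinearMap.rTensor E (A.map h).toLinearMap (ξ j) = ξ i}
  zero_mem' := by simp
  add_mem' := by
    rintro a b ⟨ha, ha'⟩ ⟨hb, hb'⟩
    refine ⟨fun i => ?_, fun i j h => ?_⟩
    · rw [Pi.add_apply, map_add, ha, hb, add_zero]
    · rw [Pi.add_apply, map_add, ha', hb', Pi.add_apply]
  smul_mem' := by
    rintro c a ⟨ha, ha'⟩
    refine ⟨fun i => ?_, fun i j h => ?_⟩
    · rw [Pi.smul_apply, map_smul, ha, smul_zero]
    · rw [Pi.smul_apply, map_smul, ha', Pi.smul_apply]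

/-- The projection of `A₊ ⊗ E` to the `i`-th term of the inverse system. -/
def FormalCDGA.at {k : Type*} [Field k] (A : FormalCDGA k) (E : Type*) [AddCommGroup E]
    [Module k E] (i : A.Idx) : A.tensor E →ₗ[k] A.Alg i ⊗[k] E :=
  LinearMap.proj i ∘ₗ (A.tensor E).subtype

/-! ### Multilinear maps with Koszul signs -/

section Multilinear

variable {k : Type*} [Field k] {V : Type*} [AddCommGroup V] [Module k V]

/-- Multiply a multilinear map by a sign that depends on the parities of its arguments: on
homogeneous arguments of parities `p`, the value of `F` is multiplied by `ε p`. -/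
noncomputable def twist {Y : Type*} [AddCommGroup Y] [Module k Y] (S : DGSpace k V) {n : ℕ}
    (ε : (Fin n → ZMod 2) → k) :
    MultilinearMap k (fun _ : Fin n => V) Y →ₗ[k] MultilinearMap k (fun _ : Fin n => V) Y :=
  ∑ p : Fin n → ZMod 2, ε p • MultilinearMap.compLinearMapₗ (fun i => S.proj (p i))

theorem proj_of_isHom [CharZero k] (S : DGSpace k V) {p q : ZMod 2} {x : V} (h : S.IsHom q x) :
    S.proj p x = if p = q then x else 0 := by
  have h2 : (2 : k)⁻¹ + 2⁻¹ = 1 := by norm_num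
  rw [DGSpace.IsHom] at h
  have key : S.proj p x = ((2 : k)⁻¹ * (1 + sgn k p * sgn k q)) • x := by
    simp [DGSpace.proj, h, mul_add, add_smul, smul_smul, mul_assoc]
  rw [key]
  have c : ∀ r : ZMod 2, r = 0 ∨ r = 1 := by decide
  have c01 := c p
  have d01 := c q
  have v1 : (1 : ZMod 2).val = 1 := rfl
  rcases c01 with rfl | rfl <;> rcases d01 with rfl | rfl <;>
    simp [sgn, v1] <;> norm_num

theorem twist_apply [CharZero k] {Y : Type*} [AddCommGroup Y] [Module k Y] (S : DGSpace k V) {n : ℕ}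
    (ε : (Fin n → ZMod 2) → k) (F : MultilinearMap k (fun _ : Fin n => V) Y) (x : Fin n → V)
    (p : Fin n → ZMod 2) (h : ∀ i, S.IsHom (p i) (x i)) : twist S ε F x = ε p • F x := by
  simp only [twist, LinearMap.sum_apply, LinearMap.smul_apply, _root_.sum_apply, smul_apply,
    MultilinearMap.compLinearMapₗ_apply, MultilinearMap.compLinearMap_apply]
  rw [sum_eq_single p]
  · congr 2
    funext i
    rw [proj_of_isHom S (h i), if_pos rfl]
  · intro q _ hq
    obtain ⟨i, hi⟩ := Function.ne_iff.mp hq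
    rw [F.map_coord_zero i (by rw [proj_of_isHom S (h i), if_neg hi]), smul_zero]
  · simp

/-- The graded symmetry of a multilinear map (under the adjacent transpositions, which generate the
symmetric group). -/
def IsSymm {Y : Type*} [AddCommMonoid Y] [Module k Y] (S : DGSpace k V) {n : ℕ}
    (f : MultilinearMap k (fun _ : Fin n => V) Y) : Prop :=
  ∀ (i j : Fin n), (j : ℕ) = i + 1 → ∀ (x : Fin n → V) (p : Fin n → ZMod 2),
    (∀ l, S.IsHom (p l) (x l)) → f (x ∘ Equiv.swap i j) = sgn k (p i * p j) • f x

/-- Cyclic invariance of `(x₀, …, xₙ) ↦ ⟨f (x₀, …, xₙ₋₁), xₙ⟩`, where `pair x y = ⟨y, x⟩`. -/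
def IsCyclic {Y Z : Type*} [AddCommMonoid Y] [Module k Y] [AddCommMonoid Z] [Module k Z]
    (S : DGSpace k V) (pair : V → Y →ₗ[k] Z) {n : ℕ}
    (f : MultilinearMap k (fun _ : Fin n => V) Y) : Prop :=
  ∀ (x : Fin (n + 1) → V) (p : Fin (n + 1) → ZMod 2), (∀ l, S.IsHom (p l) (x l)) →
    pair (x 0) (f fun i => x i.succ) =
      sgn k (p 0 * ∑ i : Fin n, p i.succ) • pair (x (Fin.last n)) (f fun i => x i.castSucc)

/-- The insertion of `h`, applied to the arguments with index in `s`, into the `r`-th slot of `g`,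
whose other slots receive the remaining arguments in their given order (without signs). -/
noncomputable def insertAt {n : ℕ} (s : Finset (Fin n)) (r : Fin (#sᶜ + 1))
    (g : MultilinearMap k (fun _ : Fin (#sᶜ + 1) => V) V)
    (h : MultilinearMap k (fun _ : Fin #s => V) V) : MultilinearMap k (fun _ : Fin n => V) V :=
  (MultilinearMap.curryFinFinset k V V (s := s) rfl rfl).symm ((g.curryMid r).compMultilinearMap h)

theorem insertAt_apply {n : ℕ} (s : Finset (Fin n)) (r : Fin (#sᶜ + 1))
    (g : MultilinearMap k (fun _ : Fin (#sᶜ + 1) => V) V)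
    (h : MultilinearMap k (fun _ : Fin #s => V) V) (x : Fin n → V) :
    insertAt s r g h x =
      g (r.insertNth (h (x ∘ s.orderEmbOfFin rfl)) (x ∘ sᶜ.orderEmbOfFin rfl)) := by
  simp [insertAt, MultilinearMap.curryFinFinset_symm_apply, Function.comp_def]

end Multilinear

/-! ### Extension of scalars -/

section Ext

variable {k : Type*} [Field k]

/-- The recursion step of `scalarExt`: `(b ⊗ w, ξ₂, …) ↦ b E (f (w, …)) (ξ₂, …)`. -/
noncomputable def scalarExtStep {k B W : Type*} [Field k] [Ring B] [Algebra k B] [AddCommGroup W]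
    [Module k W] {n : ℕ}
    (E : MultilinearMap k (fun _ : Fin n => W) (B ⊗[k] W) →ₗ[k]
      MultilinearMap k (fun _ : Fin n => B ⊗[k] W) (B ⊗[k] W)) :
    MultilinearMap k (fun _ : Fin (n + 1) => W) (B ⊗[k] W) →ₗ[k]
      MultilinearMap k (fun _ : Fin (n + 1) => B ⊗[k] W) (B ⊗[k] W) where
  toFun f := LinearMap.uncurryLeft (TensorProduct.lift
    (LinearMap.mk₂ k (fun (b : B) (w : W) =>
      (Algebra.lsmul k k (B ⊗[k] W) b).compMultilinearMap (E (f.curryLeft w)))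
      (by intros; ext; simp) (by intros; ext; simp)
      (by intros; ext; simp) (by intros; ext; simp)))
  map_add' f g := by
    have h : ∀ w, (f + g).curryLeft w = f.curryLeft w + g.curryLeft w := fun w => rfl
    ext x
    simp only [LinearMap.uncurryLeft_apply, add_apply]
    induction x 0 using TensorProduct.induction_on with
    | zero => simp
    | tmul b w => simp [h]
    | add a b ha hb => simp only [map_add, add_apply, ha, hb]; abel
  map_smul' c f := by
    have h : ∀ w, (c • f).curryLeft w = c • f.curryLeft w := fun w => rfl
    ext x
    simp only [LinearMap.uncurryLeft_apply, smul_apply, RingHom.id_apply]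
    induction x 0 using TensorProduct.induction_on with
    | zero => simp
    | tmul b w => simp [h]
    | add a b ha hb => simp only [map_add, add_apply, ha, hb, smul_add]

/-- The extension of scalars, without signs, of a multilinear map `Wⁿ → B ⊗ W` to `B ⊗ W`:
`(b₁ ⊗ w₁, …, bₙ ⊗ wₙ) ↦ b₁ ⋯ bₙ f (w₁, …, wₙ)`, cf. `scalarExt_tmul`. -/
noncomputable def scalarExt (k B W : Type*) [Field k] [Ring B] [Algebra k B] [AddCommGroup W]
    [Module k W] : (n : ℕ) → MultilinearMap k (fun _ : Fin n => W) (B ⊗[k] W) →ₗ[k]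
      MultilinearMap k (fun _ : Fin n => B ⊗[k] W) (B ⊗[k] W)
  | 0 => (MultilinearMap.constLinearEquivOfIsEmpty k k _ _).toLinearMap ∘ₗ
      (MultilinearMap.constLinearEquivOfIsEmpty k k _ _).symm.toLinearMap
  | n + 1 => scalarExtStep (scalarExt k B W n)

theorem scalarExt_tmul {k B W : Type*} [Field k] [Ring B] [Algebra k B] [AddCommGroup W]
    [Module k W] : ∀ (n : ℕ) (f : MultilinearMap k (fun _ : Fin n => W) (B ⊗[k] W))
      (b : Fin n → B) (w : Fin n → W),
      scalarExt k B W n f (fun i => b i ⊗ₜ w i) = (List.ofFn b).prod • f w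
  | 0, f, b, w => by
    rw [List.ofFn_zero, List.prod_nil, one_smul]
    exact congrArg f (Subsingleton.elim _ _)
  | n + 1, f, b, w => by
    rw [List.ofFn_succ, List.prod_cons, mul_smul]
    have h := scalarExt_tmul n (f.curryLeft (w 0)) (fun i => b i.succ) (fun i => w i.succ)
    have h' : f.curryLeft (w 0) (fun i => w i.succ) = f w := congrArg f (Fin.cons_self_tail w)
    rw [h'] at h
    rw [← h]
    rfl

/-- The `B`-multilinear extension of an odd multilinear operation `f : Wⁿ → B ⊗ W`: on homogeneous
`bᵢ` and `wᵢ`,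
`f (b₁ ⊗ w₁, …, bₙ ⊗ wₙ) = (-1)^(∑ᵢ |bᵢ| + ∑_{i<j} |wᵢ| |bⱼ|) b₁ ⋯ bₙ f (w₁, …, wₙ)`. -/
noncomputable def oddExt {B W : Type*} [Ring B] [Algebra k B] [AddCommGroup W] [Module k W]
    (C : DGSpace k B) (S : DGSpace k W) {n : ℕ}
    (f : MultilinearMap k (fun _ : Fin n => W) (B ⊗[k] W)) :
    MultilinearMap k (fun _ : Fin n => B ⊗[k] W) (B ⊗[k] W) :=
  ∑ p : Fin n → ZMod 2, ∑ q : Fin n → ZMod 2,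
    sgn k (∑ i, p i + ∑ i, ∑ j ∈ Ioi i, q i * p j) •
      (scalarExt k B W n f).compLinearMap (fun i => TensorProduct.map (C.proj (p i)) (S.proj (q i)))

theorem oddExt_tmul [CharZero k] {B W : Type*} [Ring B] [Algebra k B] [AddCommGroup W] [Module k W]
    (C : DGSpace k B) (S : DGSpace k W) {n : ℕ}
    (f : MultilinearMap k (fun _ : Fin n => W) (B ⊗[k] W)) (b : Fin n → B) (w : Fin n → W)
    (p q : Fin n → ZMod 2) (hb : ∀ i, C.IsHom (p i) (b i)) (hw : ∀ i, S.IsHom (q i) (w i)) :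
    oddExt C S f (fun i => b i ⊗ₜ w i) =
      sgn k (∑ i, p i + ∑ i, ∑ j ∈ Ioi i, q i * p j) • ((List.ofFn b).prod • f w) := by
  simp only [oddExt, _root_.sum_apply, smul_apply, MultilinearMap.compLinearMap_apply,
    TensorProduct.map_tmul, scalarExt_tmul]
  rw [sum_eq_single p, sum_eq_single q]
  · have e1 : (fun i => C.proj (p i) (b i)) = b :=
      funext fun i => by rw [proj_of_isHom C (hb i), if_pos rfl]
    have e2 : (fun i => S.proj (q i) (w i)) = w :=
      funext fun i => by rw [proj_of_isHom S (hw i), if_pos rfl]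
    rw [e1, e2]
  · intro r _ hr
    obtain ⟨i, hi⟩ := Function.ne_iff.mp hr
    rw [f.map_coord_zero i (by rw [proj_of_isHom S (hw i), if_neg hi]), smul_zero, smul_zero]
  · simp
  · intro r _ hr
    obtain ⟨i, hi⟩ := Function.ne_iff.mp hr
    have : (List.ofFn fun i => C.proj (r i) (b i)).prod = 0 := by
      have e := (MultilinearMap.mkPiAlgebraFin k n B).map_coord_zero
        (m := fun i => C.proj (r i) (b i)) i (by rw [proj_of_isHom C (hb i), if_neg hi])
      rwa [MultilinearMap.mkPiAlgebraFin_apply] at e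
    simp [this]
  · simp

end Ext

/-! ### `A`-linear `L∞` and `A∞` structures and their Maurer–Cartan elements -/

section Structures

variable {k : Type*} [Field k]

/-- The sign that moves the arguments with index in `s` to the left of all others. -/
def shuffleSgn (k : Type*) [Field k] {n : ℕ} (s : Finset (Fin n)) (p : Fin n → ZMod 2) : k :=
  sgn k (∑ a ∈ sᶜ, ∑ b ∈ s with a < b, p a * p b)

/-- The number of arguments preceding the interval `[a, b]`, as a slot of an operation which takes
the arguments outside `[a, b]` and one more. -/
def slot {n : ℕ} (a b : Fin n) : Fin (#(Icc a b)ᶜ + 1) :=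
  ⟨#{c ∈ (Icc a b)ᶜ | c < a}, Nat.lt_succ_of_le (card_filter_le _ _)⟩

section Level

variable {B W : Type*} [Ring B] [Algebra k B] [AddCommGroup W] [Module k W]

/-- The operations `fₙ : Wⁿ → B ⊗ W` are odd. -/
def IsOdd (C : DGSpace k B) (S : DGSpace k W)
    (f : ∀ n, MultilinearMap k (fun _ : Fin n => W) (B ⊗[k] W)) : Prop :=
  ∀ n x, (C.tensor S).par (f n x) = -f n fun i => S.par (x i)

/-- The differential of `Hom(Wⁿ, B ⊗ W)` applied to an odd operation `f`:
`d (f (x₁, …, xₙ)) + ∑ᵢ (-1)^(|x₁| + … + |xᵢ₋₁|) f (x₁, …, d xᵢ, …, xₙ)`, where `p i = |xᵢ|`. -/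
noncomputable def diffOdd (C : DGSpace k B) (S : DGSpace k W) {n : ℕ}
    (f : MultilinearMap k (fun _ : Fin n => W) (B ⊗[k] W)) (x : Fin n → W) (p : Fin n → ZMod 2) :
    B ⊗[k] W :=
  (C.tensor S).d (f x) +
    ∑ i, sgn k (∑ j ∈ Iio i, p j) • f (Function.update x i (S.d (x i)))

/-- The `L∞` identities: `d(mₙ) + ∑ ± m_{n-j+1} (m_j (x_s), x_{sᶜ}) = 0`, the sum running over the
`(j, n - j)`-shuffles, i.e. over the nonempty sets `s` of `j` arguments; `m_{n-j+1}` is extended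
`B`-linearly. -/
def LInftyIdentities (C : DGSpace k B) (S : DGSpace k W)
    (f : ∀ n, MultilinearMap k (fun _ : Fin n => W) (B ⊗[k] W)) : Prop :=
  ∀ (n : ℕ) (x : Fin n → W) (p : Fin n → ZMod 2), (∀ i, S.IsHom (p i) (x i)) →
    diffOdd C S (f n) x p +
      ∑ s : Finset (Fin n) with s.Nonempty, shuffleSgn k s p •
        oddExt C S (f (#sᶜ + 1)) ((0 : Fin (#sᶜ + 1)).insertNth
          (f #s (x ∘ s.orderEmbOfFin rfl))
          (fun i => (1 : B) ⊗ₜ[k] x (sᶜ.orderEmbOfFin rfl i))) = 0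

/-- The `A∞` identities: `d(mₙ) + ∑ ± m_{n-j+1} (x₁, …, m_j (x_a, …, x_b), …, xₙ) = 0`, the sum
running over all nonempty intervals `[a, b]` of arguments. -/
def AInftyIdentities (C : DGSpace k B) (S : DGSpace k W)
    (f : ∀ n, MultilinearMap k (fun _ : Fin n => W) (B ⊗[k] W)) : Prop :=
  ∀ (n : ℕ) (x : Fin n → W) (p : Fin n → ZMod 2), (∀ i, S.IsHom (p i) (x i)) →
    diffOdd C S (f n) x p +
      ∑ a : Fin n, ∑ b ∈ Ici a, sgn k (∑ i ∈ Iio a, p i) •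
        oddExt C S (f (#(Icc a b)ᶜ + 1)) ((slot a b).insertNth
          (f #(Icc a b) (x ∘ (Icc a b).orderEmbOfFin rfl))
          (fun i => (1 : B) ⊗ₜ[k] x ((Icc a b)ᶜ.orderEmbOfFin rfl i))) = 0

/-- The Maurer–Cartan equation for an even element `ξ` of `B ⊗ W`:
`d ξ + ∑_{n ≥ 1} cₙ mₙ (ξ, …, ξ) = 0`. The sum of the series is its limit in the discrete space
`B ⊗ W`, i.e. the eventual value of its partial sums. -/
def IsMC (C : DGSpace k B) (S : DGSpace k W) (c : ℕ → k)
    (f : ∀ n, MultilinearMap k (fun _ : Fin n => W) (B ⊗[k] W)) (ξ : B ⊗[k] W) : Prop :=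
  (C.tensor S).par ξ = ξ ∧
    ∀ᶠ N in atTop, (C.tensor S).d ξ + ∑ n ∈ Icc 1 N, c n • oddExt C S (f n) (fun _ => ξ) = 0

end Level

variable {W : Type*} [AddCommGroup W] [Module k W]

/-- Families of multilinear maps `mₙ : Wⁿ → A₊ ⊗ W`. -/
abbrev Ops (A : FormalCDGA k) (W : Type*) [AddCommGroup W] [Module k W] :=
  ∀ n : ℕ, MultilinearMap k (fun _ : Fin n => W) (A.tensor W)

/-- The component at `i` of a family of operations with values in `A₊ ⊗ W`. -/
def Ops.at {A : FormalCDGA k} (m : Ops A W) (i : A.Idx) (n : ℕ) :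
    MultilinearMap k (fun _ : Fin n => W) (A.Alg i ⊗[k] W) :=
  (A.at W i).compMultilinearMap (m n)

/-- `m` is an `A`-linear `L∞` structure on the dg vector space `V` with `ΠV = S`: graded symmetric
odd maps `mₙ : (ΠV)ⁿ → A₊ ⊗ ΠV`, `n ≥ 1`, which satisfy the `L∞` identities. -/
def IsLInfty (A : FormalCDGA k) (S : DGSpace k W) (m : Ops A W) : Prop :=
  m 0 = 0 ∧ (∀ n, IsSymm S (m n)) ∧
    ∀ i, IsOdd (A.cdga i).toDGSpace S (m.at i) ∧
      LInftyIdentities (A.cdga i).toDGSpace S (m.at i)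

/-- `m` is an `A`-linear `A∞` structure on the dg vector space `V` with `ΠV = S`: odd maps
`mₙ : (ΠV)ⁿ → A₊ ⊗ ΠV`, `n ≥ 1`, which satisfy the `A∞` identities. -/
def IsAInfty (A : FormalCDGA k) (S : DGSpace k W) (m : Ops A W) : Prop :=
  m 0 = 0 ∧ ∀ i, IsOdd (A.cdga i).toDGSpace S (m.at i) ∧
    AInftyIdentities (A.cdga i).toDGSpace S (m.at i)

/-- The coefficients of the Maurer–Cartan equation in an `L∞` algebra. -/
noncomputable def lieCoeff (k : Type*) [Field k] (n : ℕ) : k := (n.factorial : k)⁻¹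

/-- The coefficients of the Maurer–Cartan equation in an `A∞` algebra. -/
def assCoeff (k : Type*) [Field k] (_ : ℕ) : k := 1

/-- `MC(V, A)` for `A`-linear operations `m` on `V`, where `S = ΠV`. -/
def MC (A : FormalCDGA k) (S : DGSpace k W) (c : ℕ → k) (m : Ops A W) : Set (A.tensor W) :=
  {ξ | ∀ i, IsMC (A.cdga i).toDGSpace S c (m.at i) (A.at W i ξ)}

/-- `MC(L, A)` for an `L∞` algebra `L` over `k`: the even elements of `A₊ ⊗ ΠL` that satisfy the
Maurer–Cartan equation for the `A`-linear extension of the structure maps. Here `ΠL` is a subspace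
`K` of the dg vector space `S`, and the differential and the structure maps of `L` are the
restrictions to `K` of those of `S` and of the maps `ℓ`. -/
def bigMC (A : FormalCDGA k) (S : DGSpace k W) (K : Submodule k W)
    (ℓ : ∀ n, MultilinearMap k (fun _ : Fin n => W) W) : Set (A.tensor W) :=
  {ξ | ∀ i, A.at W i ξ ∈ LinearMap.range (K.subtype.lTensor (A.Alg i)) ∧
    IsMC (A.cdga i).toDGSpace S (lieCoeff k)
      (fun n => (TensorProduct.mk k (A.Alg i) W 1).compMultilinearMap (ℓ n)) (A.at W i ξ)}

end Structures

/-! ### Formal vector fields -/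

section Fields

variable {k : Type*} [Field k] {W : Type*} [AddCommGroup W] [Module k W]

/-- Families `(gₙ)` of multilinear maps `gₙ : Wⁿ → W`. A continuous derivation of `T̂W^*` is the same
as such a family, `gₙ` being dual to the component `W^* → (W^*)^{⊗n}` of the derivation; a
continuous derivation of `ŜW^*` is the same as a family of graded symmetric maps. It vanishes at
zero iff `g₀ = 0`. -/
abbrev Fam (k W : Type*) [Field k] [AddCommGroup W] [Module k W] :=
  ∀ n : ℕ, MultilinearMap k (fun _ : Fin n => W) W

/-- The parity involution of families: `g ↦ par ∘ g ∘ (par, …, par)`. -/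
def famPar (S : DGSpace k W) : Fam k W →ₗ[k] Fam k W where
  toFun g n := S.par.compMultilinearMap ((g n).compLinearMap fun _ => S.par)
  map_add' f g := by ext; simp
  map_smul' c f := by ext; simp

/-- `g ↦ ((x₁, …, xₙ) ↦ ∑ᵢ (-1)^(|x₁| + … + |xᵢ₋₁|) gₙ (x₁, …, d xᵢ, …, xₙ))`. -/
def famPre (S : DGSpace k W) : Fam k W →ₗ[k] Fam k W where
  toFun g n := ∑ i : Fin n, (g n).compLinearMap
    fun j => if j < i then S.par else if j = i then S.d else LinearMap.id
  map_add' f g := by ext; simp [sum_add_distrib]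
  map_smul' c f := by ext; simp [smul_sum]

/-- `g ↦ d ∘ g`. -/
def famPost (S : DGSpace k W) : Fam k W →ₗ[k] Fam k W where
  toFun g n := S.d.compMultilinearMap (g n)
  map_add' f g := by ext; simp
  map_smul' c f := by ext; simp

/-- The differential of formal vector fields induced by that of `S`: the graded commutator with `d`,
`d(g) (x₁, …, xₙ) = d (g (x₁, …, xₙ)) - (-1)^|g| ∑ᵢ ± g (x₁, …, d xᵢ, …, xₙ)`. -/
def famD (S : DGSpace k W) : Fam k W →ₗ[k] Fam k W :=
  famPost S - famPre S ∘ₗ famPar S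

theorem map_eq_neg_of_update {n : ℕ} (f : MultilinearMap k (fun _ : Fin n => W) W) (i : Fin n)
    (y z : Fin n → W) (h : ∀ j, j ≠ i → y j = z j) (hi : y i = -z i) : f y = -f z := by
  have h1 : y = Function.update z i ((-1 : k) • z i) := by
    funext j
    by_cases hj : j = i
    · subst hj; simp [hi]
    · simp [hj, h j hj]
  rw [h1, f.map_update_smul, Function.update_eq_self, neg_one_smul]

theorem famPar_famPar (S : DGSpace k W) (g : Fam k W) : famPar S (famPar S g) = g := by
  funext n
  ext x
  simp [famPar, S.par_par]

theorem famPar_famPost (S : DGSpace k W) (g : Fam k W) :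
    famPar S (famPost S g) = -famPost S (famPar S g) := by
  funext n
  ext x
  simp [famPar, famPost, S.par_d]

theorem famPre_famPost (S : DGSpace k W) (g : Fam k W) :
    famPre S (famPost S g) = famPost S (famPre S g) := by
  funext n
  ext x
  simp [famPre, famPost]

theorem famPost_famPost (S : DGSpace k W) (g : Fam k W) : famPost S (famPost S g) = 0 := by
  funext n
  ext x
  simp [famPost, S.d_d]

theorem famPar_famPre (S : DGSpace k W) (g : Fam k W) :
    famPar S (famPre S g) = -famPre S (famPar S g) := by
  funext n
  ext x
  simp only [famPar, famPre, LinearMap.coe_mk, AddHom.coe_mk, Pi.neg_apply, neg_apply,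
    LinearMap.coe_compMultilinearMap, Function.comp_apply, MultilinearMap.compLinearMap_apply,
    _root_.sum_apply, map_sum, ← sum_neg_distrib, ← map_neg]
  refine sum_congr rfl fun i _ => ?_
  rw [map_neg]
  rw [← map_neg]
  congr 1
  refine map_eq_neg_of_update _ i _ _ (fun j hj => ?_) ?_
  · by_cases h : j < i
    · simp [h]
    · simp [h, hj]
  · simp [S.par_d]

theorem famPre_famPre [CharZero k] (S : DGSpace k W) (g : Fam k W) :
    famPre S (famPre S g) = 0 := by
  funext n
  ext x
  simp only [famPre, LinearMap.coe_mk, AddHom.coe_mk, Pi.zero_apply, zero_apply,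
    MultilinearMap.compLinearMap_apply, _root_.sum_apply]
  set F : Fin n → Fin n → W := fun i j => g n fun l =>
    (if l < j then S.par else if l = j then S.d else LinearMap.id)
      ((if l < i then S.par else if l = i then S.d else LinearMap.id) (x l)) with hF
  have hlt : ∀ i j, i < j → F i j = -F j i := by
    intro i j hij
    refine map_eq_neg_of_update _ i _ _ (fun l hl => ?_) ?_
    · rcases lt_trichotomy l j with h | h | h
      · by_cases h' : l < i <;> simp [h, h', hl]
      · subst h
        simp [hij.not_gt, hij.ne']
      · simp [h.not_gt, h.ne', (hij.trans h).not_gt, hl]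
    · simp [hij, S.par_d]
  have hF' : ∀ i j, F i j = -F j i := by
    intro i j
    rcases lt_trichotomy i j with h | h | h
    · exact hlt i j h
    · subst h
      have : F i i = 0 := (g n).map_coord_zero i (by simp [S.d_d])
      simp [this]
    · rw [hlt j i h, neg_neg]
  have h : ∑ i, ∑ j, F i j = -∑ i, ∑ j, F i j := by
    conv_lhs => rw [sum_comm]
    simp only [← sum_neg_distrib]
    exact sum_congr rfl fun i _ => sum_congr rfl fun j _ => hF' j i
  have h2 : (2 : k) • ∑ i, ∑ j, F i j = 0 := by
    rw [two_smul]
    nth_rewrite 1 [h]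
    simp
  exact (smul_eq_zero.mp h2).resolve_left two_ne_zero

/-- The dg vector space of families, i.e. of (noncommutative) formal vector fields. -/
def famDG [CharZero k] (S : DGSpace k W) : DGSpace k (Fam k W) where
  par := famPar S
  d := famD S
  par_par := famPar_famPar S
  par_d g := by
    simp only [famD, LinearMap.sub_apply, LinearMap.comp_apply, map_sub, famPar_famPost,
      famPar_famPre]
    abel
  d_d g := by
    simp only [famD, LinearMap.sub_apply, LinearMap.comp_apply, map_sub, famPar_famPost,
      famPar_famPre, famPost_famPost, famPar_famPar, map_neg, famPre_famPost, famPre_famPre]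
    abel

theorem insertAt_add_left {n : ℕ} (s : Finset (Fin n)) (r : Fin (#sᶜ + 1))
    (g g' : MultilinearMap k (fun _ : Fin (#sᶜ + 1) => W) W)
    (h : MultilinearMap k (fun _ : Fin #s => W) W) :
    insertAt s r (g + g') h = insertAt s r g h + insertAt s r g' h := by
  ext; simp [insertAt_apply]

theorem insertAt_smul_left {n : ℕ} (s : Finset (Fin n)) (r : Fin (#sᶜ + 1)) (c : k)
    (g : MultilinearMap k (fun _ : Fin (#sᶜ + 1) => W) W)
    (h : MultilinearMap k (fun _ : Fin #s => W) W) :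
    insertAt s r (c • g) h = c • insertAt s r g h := by
  ext; simp [insertAt_apply]

theorem insertAt_add_right {n : ℕ} (s : Finset (Fin n)) (r : Fin (#sᶜ + 1))
    (g : MultilinearMap k (fun _ : Fin (#sᶜ + 1) => W) W)
    (h h' : MultilinearMap k (fun _ : Fin #s => W) W) :
    insertAt s r g (h + h') = insertAt s r g h + insertAt s r g h' := by
  ext x
  have := congrArg (fun f => f (x ∘ sᶜ.orderEmbOfFin rfl))
    ((g.curryMid r).map_add (h (x ∘ s.orderEmbOfFin rfl)) (h' (x ∘ s.orderEmbOfFin rfl)))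
  simp only [insertAt_apply, add_apply]
  exact this

theorem insertAt_smul_right {n : ℕ} (s : Finset (Fin n)) (r : Fin (#sᶜ + 1)) (c : k)
    (g : MultilinearMap k (fun _ : Fin (#sᶜ + 1) => W) W)
    (h : MultilinearMap k (fun _ : Fin #s => W) W) :
    insertAt s r g (c • h) = c • insertAt s r g h := by
  ext x
  have := congrArg (fun f => f (x ∘ sᶜ.orderEmbOfFin rfl))
    ((g.curryMid r).map_smul c (h (x ∘ s.orderEmbOfFin rfl)))
  simp only [insertAt_apply, smul_apply]
  exact this

section Brackets

variable [CharZero k]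

/-- The composition of formal vector fields given by the shuffles,
`(g ⋆ h)ₙ (x₁, …, xₙ) = ∑ₛ ± g (h (x_s), x_{sᶜ})`, `s` running over the nonempty sets of arguments. -/
noncomputable def lieComp (S : DGSpace k W) : Fam k W →ₗ[k] Fam k W →ₗ[k] Fam k W :=
  LinearMap.mk₂ k (fun g h n => ∑ s : Finset (Fin n) with s.Nonempty,
      twist S (shuffleSgn k s) (insertAt s 0 (g (#sᶜ + 1)) (h #s)))
    (by intros; funext n; simp [insertAt_add_left, sum_add_distrib])
    (by intros; funext n; simp [insertAt_smul_left, smul_sum])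
    (by intros; funext n; simp [insertAt_add_right, sum_add_distrib])
    (by intros; funext n; simp [insertAt_smul_right, smul_sum])

/-- The composition of noncommutative formal vector fields,
`(g ⋆ h)ₙ (x₁, …, xₙ) = ∑ (-1)^(|h| (|x₁| + … + |x_{a-1}|)) g (x₁, …, h (x_a, …, x_b), …, xₙ)`,
the sum running over the nonempty intervals of arguments. -/
noncomputable def assComp (S : DGSpace k W) : Fam k W →ₗ[k] Fam k W →ₗ[k] Fam k W :=
  LinearMap.mk₂ k (fun g h n => ∑ a : Fin n, ∑ b ∈ Ici a, ∑ q : ZMod 2,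
      twist S (fun p => sgn k (q * ∑ i ∈ Iio a, p i))
        (insertAt (Icc a b) (slot a b) (g (#(Icc a b)ᶜ + 1)) ((famDG S).proj q h #(Icc a b))))
    (by intros; funext n; simp only [Pi.add_apply, insertAt_add_left, map_add, sum_add_distrib])
    (by intros; funext n; simp only [Pi.smul_apply, insertAt_smul_left, map_smul, smul_sum])
    (by intros; funext n; simp only [Pi.add_apply, insertAt_add_right, map_add, sum_add_distrib])
    (by intros; funext n; simp only [Pi.smul_apply, insertAt_smul_right, map_smul, smul_sum])

/-- The graded commutator `[g, h] = g ⋆ h - (-1)^(|g| |h|) h ⋆ g` of a composition of families. -/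
noncomputable def bracket (S : DGSpace k W) (comp : Fam k W →ₗ[k] Fam k W →ₗ[k] Fam k W) :
    Fam k W →ₗ[k] Fam k W →ₗ[k] Fam k W :=
  comp - ∑ p : ZMod 2, ∑ q : ZMod 2,
    sgn k (p * q) • (comp.compl₁₂ ((famDG S).proj q) ((famDG S).proj p)).flip

/-- The graded symmetrization `gₙ ↦ ∑_{σ ∈ Sₙ} σ gₙ`: the map from noncommutative to commutative
formal vector fields which is induced by the projection of `T̂W^*` to `ŜW^*`. -/
noncomputable def symmetrize (S : DGSpace k W) : Fam k W →ₗ[k] Fam k W where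
  toFun g n := ∑ σ : Equiv.Perm (Fin n),
    twist S (fun p => sgn k (∑ i, ∑ j ∈ Ioi i, if σ j < σ i then p (σ i) * p (σ j) else 0))
      ((g n).domDomCongr σ)
  map_add' f g := by
    funext n
    refine Eq.trans ?_ sum_add_distrib
    exact sum_congr rfl fun σ _ => by rw [← map_add]; rfl
  map_smul' c f := by
    funext n
    refine Eq.trans ?_ (smul_sum (r := c)).symm
    exact sum_congr rfl fun σ _ => by rw [← map_smul]; rfl

/-! ### The `L∞` extension of formal vector fields by `V`

For a Lie algebra `𝔥` of formal vector fields with bracket `br`, which acts on `W = ΠV` through the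
map `ρ` to commutative formal vector fields, `Π(𝔥 ⊕ V)` has the underlying space `𝔥 × W`. The
formulas for the structure maps make sense for all families; the `L∞` algebra `𝔥 ⊕ V` is the
restriction to a Lie algebra `𝔥` (`lieFields`, `assFields`, or their symplectic parts). -/

/-- The dg vector space `Π(𝔥 ⊕ V) = Π𝔥 ⊕ W`, for `𝔥` the space of all families. -/
def extDG (S : DGSpace k W) : DGSpace k (Fam k W × W) :=
  ((famDG S).shift).prod S

/-- The part of the structure maps given by the bracket: `m₂ (Πg, Πh) = (-1)^|g| Π[g, h]`. -/
noncomputable def bracketOp (S : DGSpace k W) (br : Fam k W →ₗ[k] Fam k W →ₗ[k] Fam k W) :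
    ∀ n, MultilinearMap k (fun _ : Fin n => Fam k W × W) (Fam k W × W)
  | 2 => LinearMap.uncurryLeft
      ((MultilinearMap.ofSubsingletonₗ k k (Fam k W × W) (Fam k W × W) (0 : Fin 1)).toLinearMap ∘ₗ
        (br.compl₁₂ (famPar S ∘ₗ LinearMap.fst k (Fam k W) W) (LinearMap.fst k (Fam k W) W)).compr₂
          (LinearMap.inl k (Fam k W) W))
  | _ => 0

/-- The part of the structure maps given by the action on `V`:
`mₙ₊₁ (Πg, w₁, …, wₙ) = ρ(g)ₙ (w₁, …, wₙ)`, extended to all orders of the arguments by graded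
symmetry. -/
noncomputable def actionOp (S : DGSpace k W) (ρ : Fam k W →ₗ[k] Fam k W) :
    ∀ n, MultilinearMap k (fun _ : Fin n => Fam k W × W) (Fam k W × W)
  | 0 => 0
  | n + 1 => ∑ i : Fin (n + 1), twist (extDG S) (fun p => sgn k (p i * ∑ j ∈ Iio i, p j))
      (LinearMap.uncurryMid i
        (LinearMap.compMultilinearMapₗ k (LinearMap.inr k (Fam k W) W) ∘ₗ
          MultilinearMap.compLinearMapₗ (fun _ => LinearMap.snd k (Fam k W) W) ∘ₗ
          LinearMap.proj n ∘ₗ ρ ∘ₗ LinearMap.fst k (Fam k W) W))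

/-- The structure maps of the `L∞` algebra `𝔥 ⊕ V`; the only nonzero ones are those of `bracketOp` and
`actionOp`, up to symmetry. -/
noncomputable def extOps (S : DGSpace k W) (br : Fam k W →ₗ[k] Fam k W →ₗ[k] Fam k W)
    (ρ : Fam k W →ₗ[k] Fam k W) (n : ℕ) :
    MultilinearMap k (fun _ : Fin n => Fam k W × W) (Fam k W × W) :=
  bracketOp S br n + actionOp S ρ n

end Brackets

theorem bracketOp_two (S : DGSpace k W) (br : Fam k W →ₗ[k] Fam k W →ₗ[k] Fam k W)
    (x : Fin 2 → Fam k W × W) :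
    bracketOp S br 2 x = (br (famPar S (x 0).1) (x 1).1, 0) := by
  simp [bracketOp, Fin.tail]

/-- `𝔞(V)`, for `W = ΠV`: continuous derivations of `T̂W^*` vanishing at zero. -/
def assFields (k W : Type*) [Field k] [AddCommGroup W] [Module k W] : Submodule k (Fam k W) where
  carrier := {g | g 0 = 0}
  zero_mem' := rfl
  add_mem' := by intro f g hf hg; simp_all
  smul_mem' := by intro c f hf; simp_all

/-- `𝔠(V)`, for `S = ΠV`: continuous derivations of `ŜW^*` vanishing at zero. -/
def lieFields (S : DGSpace k W) : Submodule k (Fam k W) where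
  carrier := {g | g 0 = 0 ∧ ∀ n, IsSymm S (g n)}
  zero_mem' := ⟨rfl, fun n i j _ x p _ => by simp⟩
  add_mem' := by
    rintro f g ⟨hf, hf'⟩ ⟨hg, hg'⟩
    refine ⟨by simp [hf, hg], fun n i j hij x p hx => ?_⟩
    simp [hf' n i j hij x p hx, hg' n i j hij x p hx]
  smul_mem' := by
    rintro c f ⟨hf, hf'⟩
    refine ⟨by simp [hf], fun n i j hij x p hx => ?_⟩
    simp [hf' n i j hij x p hx, smul_smul, mul_comm]

/-- A symmetric non-degenerate scalar product on the dg vector space `S`, i.e. a map of dg vector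
spaces `V ⊗ V → k` which is graded symmetric and non-degenerate. -/
structure ScalarProduct {V : Type*} [AddCommGroup V] [Module k V] (S : DGSpace k V) where
  form : V →ₗ[k] V →ₗ[k] k
  even : ∀ x y, form (S.par x) (S.par y) = form x y
  closed : ∀ x y, form (S.d x) y + form (S.par x) (S.d y) = 0
  symm : ∀ p q x y, S.IsHom p x → S.IsHom q y → form x y = sgn k (p * q) * form y x
  nondegenerate : ∀ x, (∀ y, form x y = 0) → x = 0

/-- The symplectic form on `ΠV` of a scalar product on `V`: `ω (Πx, Πy) = (-1)^|x| ⟨x, y⟩`. -/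
def ScalarProduct.omega {V : Type*} [AddCommGroup V] [Module k V] {S : DGSpace k V}
    (β : ScalarProduct S) : V →ₗ[k] V →ₗ[k] k :=
  β.form ∘ₗ S.par

/-- The families which are symplectic for `ω`: the maps
`(x₀, …, xₙ) ↦ ω (gₙ (x₀, …, xₙ₋₁), xₙ)` are cyclically invariant. -/
def sympFields (S : DGSpace k W) (ω : W →ₗ[k] W →ₗ[k] k) : Submodule k (Fam k W) where
  carrier := {g | ∀ n, IsCyclic S ω.flip (g n)}
  zero_mem' := fun n x p _ => by simp
  add_mem' := by
    intro f g hf hg n x p hx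
    have h1 := hf n x p hx
    have h2 := hg n x p hx
    simp only [Pi.add_apply, add_apply, map_add, h1, h2, smul_add]
  smul_mem' := by
    intro c f hf n x p hx
    have h1 := hf n x p hx
    simp only [Pi.smul_apply, smul_apply, map_smul, h1]
    rw [smul_comm]

/-- The operations `m` on `ΠV = S` are cyclic: the maps
`(x₀, …, xₙ) ↦ ω (mₙ (x₀, …, xₙ₋₁), xₙ) ∈ A₊` are cyclically invariant. -/
def IsCyclicOps (A : FormalCDGA k) (S : DGSpace k W) (ω : W →ₗ[k] W →ₗ[k] k) (m : Ops A W) : Prop :=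
  ∀ i n, IsCyclic S
    (fun y => (TensorProduct.rid k (A.Alg i)).toLinearMap ∘ₗ (ω.flip y).lTensor (A.Alg i)) (m.at i n)

/-! ### The four `L∞` algebras, and the identification of their elements -/

section Ext

variable [CharZero k] {V : Type*} [AddCommGroup V] [Module k V]

/-- `MC(𝔠̃(V), A)`. -/
def mcLie (A : FormalCDGA k) (S : DGSpace k V) : Set (A.tensor (Fam k V × V)) :=
  bigMC A (extDG S.shift) ((lieFields S.shift).prod ⊤)
    (extOps S.shift (bracket S.shift (lieComp S.shift)) LinearMap.id)

/-- `MC(𝔠̃𝔰(V), A)`. -/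
def mcCyclicLie (A : FormalCDGA k) (S : DGSpace k V) (β : ScalarProduct S) :
    Set (A.tensor (Fam k V × V)) :=
  bigMC A (extDG S.shift) ((lieFields S.shift ⊓ sympFields S.shift β.omega).prod ⊤)
    (extOps S.shift (bracket S.shift (lieComp S.shift)) LinearMap.id)

/-- `MC(𝔞̃(V), A)`. -/
def mcAss (A : FormalCDGA k) (S : DGSpace k V) : Set (A.tensor (Fam k V × V)) :=
  bigMC A (extDG S.shift) ((assFields k V).prod ⊤)
    (extOps S.shift (bracket S.shift (assComp S.shift)) (symmetrize S.shift))

/-- `MC(𝔞̃𝔰(V), A)`. -/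
def mcCyclicAss (A : FormalCDGA k) (S : DGSpace k V) (β : ScalarProduct S) :
    Set (A.tensor (Fam k V × V)) :=
  bigMC A (extDG S.shift) ((assFields k V ⊓ sympFields S.shift β.omega).prod ⊤)
    (extOps S.shift (bracket S.shift (assComp S.shift)) (symmetrize S.shift))

end Ext

/-- The evaluation of the `n`-th component of a family. -/
def evalAt (n : ℕ) (x : Fin n → W) : Fam k W →ₗ[k] W where
  toFun g := g n x
  map_add' _ _ := rfl
  map_smul' _ _ := rfl

/-- The map `id ⊗ f` from `A₊ ⊗ E` to `A₊ ⊗ E'`. -/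
noncomputable def FormalCDGA.tensorMap (A : FormalCDGA k) {E E' : Type*} [AddCommGroup E]
    [Module k E] [AddCommGroup E'] [Module k E'] (f : E →ₗ[k] E') : A.tensor E →ₗ[k] A.tensor E' :=
  LinearMap.restrict
    (LinearMap.pi fun i => f.lTensor (A.Alg i) ∘ₗ LinearMap.proj i) (by
      rintro ξ ⟨h, h'⟩
      refine ⟨fun i => ?_, fun i j hij => ?_⟩
      · have := congrArg (f.lTensor k) (h i)
        rw [map_zero, ← LinearMap.comp_apply, LinearMap.lTensor_comp_rTensor] at this
        rw [← this, LinearMap.pi_apply, LinearMap.comp_apply, LinearMap.proj_apply,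
          ← LinearMap.comp_apply, LinearMap.rTensor_comp_lTensor]
      · rw [LinearMap.pi_apply, LinearMap.comp_apply, LinearMap.proj_apply,
          LinearMap.pi_apply, LinearMap.comp_apply, LinearMap.proj_apply, ← h' i j hij,
          ← LinearMap.comp_apply, LinearMap.rTensor_comp_lTensor, ← LinearMap.comp_apply,
          LinearMap.lTensor_comp_rTensor])

/-- The parity involution of `A`, acting on `A₊ ⊗ E`. -/
noncomputable def FormalCDGA.parMap (A : FormalCDGA k) (E : Type*) [AddCommGroup E]
    [Module k E] : A.tensor E →ₗ[k] A.tensor E :=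
  LinearMap.restrict
    (LinearMap.pi fun i => (A.cdga i).par.rTensor E ∘ₗ LinearMap.proj i) (by
      rintro ξ ⟨h, h'⟩
      refine ⟨fun i => ?_, fun i j hij => ?_⟩
      · have e : (A.cdga i).aug.toLinearMap ∘ₗ (A.cdga i).par = (A.cdga i).aug.toLinearMap := by
          ext a; exact (A.cdga i).aug_par a
        rw [LinearMap.pi_apply, LinearMap.comp_apply, LinearMap.proj_apply,
          ← LinearMap.comp_apply, ← LinearMap.rTensor_comp, e, h]
      · have e : (A.map hij).toLinearMap ∘ₗ (A.cdga j).par =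
            (A.cdga i).par ∘ₗ (A.map hij).toLinearMap := by
          ext a; exact A.map_par hij a
        have := congrArg ((A.cdga i).par.rTensor E) (h' i j hij)
        rw [← LinearMap.comp_apply, ← LinearMap.rTensor_comp, ← e] at this
        rw [LinearMap.pi_apply, LinearMap.comp_apply, LinearMap.proj_apply,
          LinearMap.pi_apply, LinearMap.comp_apply, LinearMap.proj_apply, ← this,
          LinearMap.rTensor_comp, LinearMap.comp_apply])

/-- The identification of an element of `A₊ ⊗ (Π𝔥 ⊕ ΠV)` with a family of operations
`(ΠV)ⁿ → A₊ ⊗ ΠV` and an element of `A₊ ⊗ ΠV`. It sends `a ⊗ Πg` to the operations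
`(x₁, …, xₙ) ↦ (-1)^|a| a ⊗ gₙ (x₁, …, xₙ)` (the sign is that of the exchange of `Π` and `a`) and
`a ⊗ w` to `a ⊗ w`. -/
noncomputable def split (A : FormalCDGA k) (ξ : A.tensor (Fam k W × W)) :
    Ops A W × A.tensor W :=
  (fun n =>
    { toFun := fun x => A.parMap W (A.tensorMap (evalAt n x ∘ₗ LinearMap.fst k (Fam k W) W) ξ)
      map_update_add' := by
        intro _ x i y z
        have e : evalAt (k := k) n (Function.update x i (y + z)) =
            evalAt n (Function.update x i y) + evalAt n (Function.update x i z) := by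
          ext g; exact (g n).map_update_add x i y z
        rw [← map_add, e, LinearMap.add_comp]
        congr 1
        ext j
        simp [FormalCDGA.tensorMap, LinearMap.restrict, LinearMap.lTensor_add]
      map_update_smul' := by
        intro _ x i c y
        have e : evalAt (k := k) n (Function.update x i (c • y)) =
            c • evalAt n (Function.update x i y) := by
          ext g; exact (g n).map_update_smul x i c y
        rw [← map_smul, e, LinearMap.smul_comp]
        congr 1
        ext j
        simp [FormalCDGA.tensorMap, LinearMap.restrict, LinearMap.lTensor_smul] },
    A.tensorMap (LinearMap.snd k (Fam k W) W) ξ)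

end Fields
end MCFields

/-! The Maurer–Cartan equation in `𝔥 ⊕ V` splits according to its values. The component in `Π𝔥` is
the system of structure identities for the operations `m`; the component in `ΠV` is the
Maurer–Cartan equation for `ξ` in the structure `m`.

Everything is checked at the finite-dimensional algebras `B = Aᵢ`. There the map from `B ⊗ ∏ₙ
Hom(Wⁿ, W)` to `∏ₙ Hom(Wⁿ, B ⊗ W)` is bijective (`tensorEval_ext`, `exists_tensorEval_eq`), which
makes `split` a bijection. Vanishing in arity zero, graded symmetry and cyclicity are linear
conditions, so they hold for the operations iff they hold for every coefficient with respect to a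
basis of `B`.

Write an even element as `ζ = ∑ e_a ⊗ (g_a, w_a)`, with `e_a` and `w_a` of parity `p_a` and `g_a` of
parity `p_a + 1`; its operations are `m = ∑ (-1)^(p_a) e_a ⊗ g_a`. In `m₂(ζ, ζ)` the graded
commutator produces every composition twice, so the factor `1/2!` disappears and a single sum of
terms `± e_a e_b ⊗ g_a ⋆ g_b` remains (`oddExt_bracketOp`). Evaluated on arguments, this sum gives
the quadratic terms of the structure identities (`lie_quadratic`, `ass_quadratic`), and the
differentials correspond by `diffOdd_tensorEval`.

In `mₙ₊₁(ζ, …, ζ)` the vector field can sit in any of `n + 1` slots with the same result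
(`oddExt_actionOp`), which turns `1/(n+1)!` into `1/n!` in front of `ρ(m)ₙ(ξ, …, ξ)`. For `ρ = id`
this is the `L∞` equation. For the symmetrization, all `n!` permutations agree on an even `ξ`
(`oddExt_symmetrize`), so the coefficient becomes `1`, as in the `A∞` equation. These computations
are assembled in `isMC_extOps_iff`. -/

namespace MCFields

/-! ### Signs -/

section Signs

variable {k : Type*} [Field k]

theorem sgn_zero : sgn k 0 = 1 := by simp [sgn]

theorem sgn_one : sgn k 1 = -1 := by
  have : (1 : ZMod 2).val = 1 := rfl
  simp [sgn, this]

theorem zmod_two_cases : ∀ r : ZMod 2, r = 0 ∨ r = 1 := by decide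

theorem sgn_add (p q : ZMod 2) : sgn k (p + q) = sgn k p * sgn k q := by
  have h : (1 + 1 : ZMod 2) = 0 := rfl
  rcases zmod_two_cases p with rfl | rfl <;> rcases zmod_two_cases q with rfl | rfl <;>
    simp [sgn_zero, sgn_one, h]

theorem sgn_mul_self (p : ZMod 2) : sgn k p * sgn k p = 1 := by
  rw [← sgn_add, CharTwo.add_self_eq_zero, sgn_zero]

theorem sgn_sum {ι : Type*} (s : Finset ι) (p : ι → ZMod 2) :
    sgn k (∑ i ∈ s, p i) = ∏ i ∈ s, sgn k (p i) := by
  classical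
  induction s using Finset.induction_on with
  | empty => simp [sgn_zero]
  | insert a s ha ih => rw [sum_insert ha, prod_insert ha, sgn_add, ih]

theorem sgn_smul_sgn_smul {M : Type*} [AddCommMonoid M] [Module k M] (p : ZMod 2) (x : M) :
    sgn k p • sgn k p • x = x := by
  rw [smul_smul, sgn_mul_self, one_smul]

end Signs

/-! ### Sums over ordered pairs of indices -/

section Pairs

variable {M : Type*} [AddCommMonoid M]

theorem sum_Ioi_eq_sum_ite {n : ℕ} (f : Fin n → Fin n → M) :
    ∑ i, ∑ j ∈ Ioi i, f i j = ∑ i, ∑ j, if i < j then f i j else 0 := by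
  refine sum_congr rfl fun i _ => ?_
  rw [← sum_filter]
  exact sum_congr (by ext; simp) fun _ _ => rfl

/-- Separates the pairs that contain `r` from those that do not. Koszul exponents are sums over
pairs, so this is how they change when one argument is singled out. -/
theorem sum_Ioi_succAbove {n : ℕ} (r : Fin (n + 1)) (f : Fin (n + 1) → Fin (n + 1) → M) :
    ∑ i, ∑ j ∈ Ioi i, f i j =
      ∑ j, (if r < r.succAbove j then f r (r.succAbove j) else f (r.succAbove j) r) +
        ∑ i, ∑ j ∈ Ioi i, f (r.succAbove i) (r.succAbove j) := by
  simp only [sum_Ioi_eq_sum_ite]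
  rw [Fin.sum_univ_succAbove _ r, Fin.sum_univ_succAbove _ r]
  simp only [Fin.sum_univ_succAbove _ r, lt_irrefl, if_false, zero_add,
    Fin.succAbove_lt_succAbove_iff, sum_add_distrib, ← add_assoc]
  congr 1
  rw [← sum_add_distrib]
  refine sum_congr rfl fun j _ => ?_
  rcases lt_or_gt_of_ne (Fin.succAbove_ne r j) with h | h
  · simp [h, h.not_gt]
  · simp [h, h.not_gt]

/-- The remaining values of `σ` avoid `σ 0`, and `succAbove` enumerates the complement of that
value. This is the induction step for statements about permutations. -/
theorem exists_perm_succAbove {n : ℕ} (σ : Equiv.Perm (Fin (n + 1))) :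
    ∃ τ : Equiv.Perm (Fin n), ∀ j, σ j.succ = (σ 0).succAbove (τ j) := by
  have h : ∀ j : Fin n, ∃ l, (σ 0).succAbove l = σ j.succ := fun j =>
    Fin.exists_succAbove_eq fun e => Fin.succ_ne_zero j (σ.injective e)
  choose τ hτ using h
  have hinj : Function.Injective τ := fun a b e => by
    have := (hτ a).symm.trans ((congrArg _ e).trans (hτ b))
    exact Fin.succ_injective _ (σ.injective this)
  exact ⟨Equiv.ofBijective τ (Finite.injective_iff_bijective.mp hinj), fun j => (hτ j).symm⟩

/-- For symmetric `f` this is a sum over unordered pairs, which `σ` merely permutes. The induction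
removes `0` on one side and `σ 0` on the other. -/
theorem sum_Ioi_perm : ∀ {n : ℕ} (σ : Equiv.Perm (Fin n)) (f : Fin n → Fin n → M)
    (_ : ∀ i j, f i j = f j i), ∑ i, ∑ j ∈ Ioi i, f (σ i) (σ j) = ∑ i, ∑ j ∈ Ioi i, f i j
  | 0, _, _, _ => by simp
  | n + 1, σ, f, hf => by
    obtain ⟨τ, hτ⟩ := exists_perm_succAbove σ
    rw [sum_Ioi_succAbove 0, sum_Ioi_succAbove (σ 0) f]
    simp only [Fin.zero_succAbove, Fin.succ_pos, if_true, hτ]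
    rw [sum_Ioi_perm τ (fun i j => f ((σ 0).succAbove i) ((σ 0).succAbove j))
      fun i j => hf _ _, Equiv.sum_comp τ fun j => f (σ 0) ((σ 0).succAbove j)]
    congr 1
    refine sum_congr rfl fun j _ => ?_
    split_ifs
    · rfl
    · exact hf _ _

end Pairs

/-! ### Homogeneous elements -/

section Homogeneous

variable {k : Type*} [Field k] {V : Type*} [AddCommGroup V] [Module k V]

theorem DGSpace.proj_isHom (S : DGSpace k V) (p : ZMod 2) (x : V) : S.IsHom p (S.proj p x) := by
  rw [DGSpace.IsHom]
  simp only [DGSpace.proj, LinearMap.smul_apply, LinearMap.add_apply, LinearMap.id_apply,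
    map_smul, map_add, S.par_par]
  rw [smul_comm (sgn k p) (2 : k)⁻¹, smul_add (sgn k p), sgn_smul_sgn_smul, smul_add, smul_add,
    add_comm]

theorem DGSpace.sum_proj [CharZero k] (S : DGSpace k V) (x : V) : ∑ p, S.proj p x = x := by
  have h : (Finset.univ : Finset (ZMod 2)) = {0, 1} := rfl
  rw [h, sum_pair (by decide)]
  simp only [DGSpace.proj, LinearMap.smul_apply, LinearMap.add_apply, LinearMap.id_apply,
    sgn_zero, sgn_one, one_smul, neg_smul, LinearMap.neg_apply]
  rw [← smul_add, add_add_add_comm, add_neg_cancel, add_zero, ← two_smul k x, smul_smul,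
    inv_mul_cancel₀ two_ne_zero, one_smul]

theorem DGSpace.IsHom.smul {S : DGSpace k V} {p : ZMod 2} {x : V} (h : S.IsHom p x) (c : k) :
    S.IsHom p (c • x) := by
  rw [DGSpace.IsHom] at *
  rw [map_smul, h, smul_comm]

/-- A multilinear map is determined by its values on homogeneous arguments. -/
theorem multilinear_ext_isHom [CharZero k] (S : DGSpace k V) {Y : Type*} [AddCommGroup Y]
    [Module k Y] {n : ℕ} {f g : MultilinearMap k (fun _ : Fin n => V) Y}
    (h : ∀ (x : Fin n → V) (p : Fin n → ZMod 2), (∀ i, S.IsHom (p i) (x i)) → f x = g x) :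
    f = g := by
  ext x
  have e : x = fun i => ∑ p, S.proj p (x i) := funext fun i => (S.sum_proj (x i)).symm
  rw [e, MultilinearMap.map_sum, MultilinearMap.map_sum]
  exact sum_congr rfl fun p _ => h _ p fun i => S.proj_isHom (p i) (x i)

variable {U : Type*} [AddCommGroup U] [Module k U]

theorem tensor_d_tmul (S : DGSpace k V) (T : DGSpace k U) (x : V) (y : U) :
    (S.tensor T).d (x ⊗ₜ y) = S.d x ⊗ₜ y + S.par x ⊗ₜ T.d y := rfl

/-- An even element of a tensor product is a sum of products of homogeneous elements of the same
parity. -/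
theorem exists_sum_tmul_isHom [CharZero k] (S : DGSpace k V) (T : DGSpace k U) (t : V ⊗[k] U)
    (ht : (S.tensor T).par t = t) :
    ∃ (m : ℕ) (p : Fin m → ZMod 2) (x : Fin m → V) (y : Fin m → U),
      (∀ a, S.IsHom (p a) (x a)) ∧ (∀ a, T.IsHom (p a) (y a)) ∧ t = ∑ a, x a ⊗ₜ[k] y a := by
  -- The statement for `t + par t` needs no evenness, so it can be proved by induction on tensors;
  -- for even `t` this element is `2 t`.
  have key : ∀ t : V ⊗[k] U, ∃ (m : ℕ) (p : Fin m → ZMod 2) (x : Fin m → V) (y : Fin m → U),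
      (∀ a, S.IsHom (p a) (x a)) ∧ (∀ a, T.IsHom (p a) (y a)) ∧
        t + (S.tensor T).par t = ∑ a, x a ⊗ₜ[k] y a := by
    intro t
    induction t using TensorProduct.induction_on with
    | zero => exact ⟨0, Fin.elim0, Fin.elim0, Fin.elim0, fun a => a.elim0, fun a => a.elim0, by simp⟩
    | tmul b w =>
      -- In `b ⊗ w + par b ⊗ par w` the terms of mixed parity cancel and those of equal parity
      -- double.
      refine ⟨2, ![0, 1], ![(2 : k) • S.proj 0 b, (2 : k) • S.proj 1 b],
        ![T.proj 0 w, T.proj 1 w], fun a => ?_, fun a => ?_, ?_⟩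
      · fin_cases a
        · exact (S.proj_isHom 0 b).smul 2
        · exact (S.proj_isHom 1 b).smul 2
      · fin_cases a
        · exact T.proj_isHom 0 w
        · exact T.proj_isHom 1 w
      · simp only [Fin.sum_univ_two, Matrix.cons_val_zero, Matrix.cons_val_one, DGSpace.proj,
          DGSpace.tensor, TensorProduct.map_tmul, LinearMap.smul_apply, LinearMap.add_apply,
          LinearMap.id_apply, LinearMap.neg_apply, sgn_zero, sgn_one, one_smul, neg_smul, smul_smul,
          mul_inv_cancel₀ (two_ne_zero' k), TensorProduct.tmul_smul, TensorProduct.tmul_add,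
          TensorProduct.add_tmul, TensorProduct.tmul_neg, TensorProduct.neg_tmul]
        module
    | add s t hs ht =>
      obtain ⟨m, p, x, y, hx, hy, e⟩ := hs
      obtain ⟨m', p', x', y', hx', hy', e'⟩ := ht
      refine ⟨m + m', Fin.append p p', Fin.append x x', Fin.append y y', fun a => ?_, fun a => ?_, ?_⟩
      · refine Fin.addCases (fun a => ?_) (fun a => ?_) a
        · simpa using hx a
        · simpa using hx' a
      · refine Fin.addCases (fun a => ?_) (fun a => ?_) a
        · simpa using hy a
        · simpa using hy' a
      · rw [Fin.sum_univ_add]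
        simp only [Fin.append_left, Fin.append_right]
        rw [map_add, add_add_add_comm, e, e']
  obtain ⟨m, p, x, y, hx, hy, e⟩ := key t
  refine ⟨m, p, fun a => (2 : k)⁻¹ • x a, y, fun a => (hx a).smul _, hy, ?_⟩
  simp only [← TensorProduct.smul_tmul', ← smul_sum, ← e, ht]
  rw [← two_smul k t, smul_smul, inv_mul_cancel₀ two_ne_zero, one_smul]

end Homogeneous

/-! ### Products in graded commutative algebras -/

section Products

variable {k : Type*} [Field k] {B : Type*} [Ring B] [Algebra k B]

theorem par_one {C : DGSpace k B} (hmul : ∀ a b, C.par (a * b) = C.par a * C.par b) :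
    C.par 1 = 1 := by
  have h := hmul (C.par 1) 1
  rw [mul_one, C.par_par, one_mul] at h
  exact h.symm

theorem isHom_one {C : DGSpace k B} (hmul : ∀ a b, C.par (a * b) = C.par a * C.par b) :
    C.IsHom 0 1 := by
  rw [DGSpace.IsHom, par_one hmul, sgn_zero, one_smul]

theorem isHom_mul {C : DGSpace k B} (hmul : ∀ a b, C.par (a * b) = C.par a * C.par b)
    {p q : ZMod 2} {a b : B} (ha : C.IsHom p a) (hb : C.IsHom q b) : C.IsHom (p + q) (a * b) := by
  rw [DGSpace.IsHom] at *
  rw [hmul, ha, hb, smul_mul_smul_comm, sgn_add]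

theorem isHom_prod_ofFn {C : DGSpace k B} (hmul : ∀ a b, C.par (a * b) = C.par a * C.par b) :
    ∀ {n : ℕ} {b : Fin n → B} {p : Fin n → ZMod 2}, (∀ i, C.IsHom (p i) (b i)) →
      C.IsHom (∑ i, p i) (List.ofFn b).prod
  | 0, _, _, _ => by simpa using isHom_one hmul
  | n + 1, b, p, h => by
    rw [List.ofFn_succ, List.prod_cons, Fin.sum_univ_succ]
    exact isHom_mul hmul (h 0) (isHom_prod_ofFn hmul fun i => h i.succ)

/-- Moving the factor with index `r` to the left. -/
theorem prod_ofFn_succAbove {C : DGSpace k B}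
    (hcomm : ∀ p q a b, C.IsHom p a → C.IsHom q b → a * b = sgn k (p * q) • (b * a)) :
    ∀ {n : ℕ} (r : Fin (n + 1)) {b : Fin (n + 1) → B} {p : Fin (n + 1) → ZMod 2},
      (∀ i, C.IsHom (p i) (b i)) → (List.ofFn b).prod =
        sgn k (p r * ∑ j, if r < r.succAbove j then 0 else p (r.succAbove j)) •
          (b r * (List.ofFn fun j => b (r.succAbove j)).prod)
  | n, r, b, p, h => by
    induction r using Fin.cases with
    | zero =>
      rw [List.ofFn_succ, List.prod_cons]
      simp [sgn_zero]
    | succ r =>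
      cases n with
      | zero => exact r.elim0
      | succ n =>
        -- The factor moves to the front of the tail by induction, and then past `b 0`.
        rw [List.ofFn_succ, List.prod_cons, prod_ofFn_succAbove hcomm r fun i => h i.succ,
          List.ofFn_succ, List.prod_cons, mul_smul_comm, ← mul_assoc, hcomm _ _ _ _ (h 0) (h r.succ),
          smul_mul_assoc, mul_assoc, smul_smul, ← sgn_add, Fin.sum_univ_succ]
        simp only [Fin.succ_succAbove_zero, Fin.succ_succAbove_succ, Fin.succ_lt_succ_iff,
          Fin.not_lt_zero, if_false]
        congr 2
        ring

/-- Each inversion of `σ` exchanges two factors once and contributes the product of their parities.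
Inductively, the factor with index `σ 0` is moved to the front and the others are reordered. -/
theorem prod_ofFn_perm {C : DGSpace k B}
    (hcomm : ∀ p q a b, C.IsHom p a → C.IsHom q b → a * b = sgn k (p * q) • (b * a)) :
    ∀ {n : ℕ} (σ : Equiv.Perm (Fin n)) {b : Fin n → B} {p : Fin n → ZMod 2},
      (∀ i, C.IsHom (p i) (b i)) → (List.ofFn b).prod =
        sgn k (∑ i, ∑ j ∈ Ioi i, if σ j < σ i then p (σ i) * p (σ j) else 0) •
          (List.ofFn fun i => b (σ i)).prod
  | 0, _, _, _, _ => by simp [sgn_zero]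
  | n + 1, σ, b, p, h => by
    obtain ⟨τ, hτ⟩ := exists_perm_succAbove σ
    rw [prod_ofFn_succAbove hcomm (σ 0) h, prod_ofFn_perm hcomm τ fun i => h _, List.ofFn_succ,
      List.prod_cons, mul_smul_comm, smul_smul, ← sgn_add]
    simp only [hτ]
    congr 2
    rw [sum_Ioi_succAbove 0]
    simp only [Fin.zero_succAbove, Fin.succ_pos, if_true, hτ, Fin.succAbove_lt_succAbove_iff]
    congr 1
    rw [← Equiv.sum_comp τ, mul_sum]
    refine sum_congr rfl fun j _ => ?_
    rcases lt_or_gt_of_ne (Fin.succAbove_ne (σ 0) (τ j)) with h | h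
    · simp [h, h.not_gt]
    · simp [h, h.not_gt]

end Products

/-! ### Coordinates of a tensor with respect to a basis of the left factor -/

section Coordinates

theorem rTensor_lTensor_comm {k M M' E F : Type*} [Field k] [AddCommGroup M] [Module k M]
    [AddCommGroup M'] [Module k M'] [AddCommGroup E] [Module k E] [AddCommGroup F] [Module k F]
    (φ : M →ₗ[k] M') (f : E →ₗ[k] F) (t : M ⊗[k] E) :
    φ.rTensor F (f.lTensor M t) = f.lTensor M' (φ.rTensor E t) := by
  rw [← LinearMap.comp_apply, ← LinearMap.comp_apply, LinearMap.rTensor_comp_lTensor,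
    LinearMap.lTensor_comp_rTensor]

variable {k : Type*} [Field k] {M : Type*} [AddCommGroup M] [Module k M]
  {E : Type*} [AddCommGroup E] [Module k E] {F : Type*} [AddCommGroup F] [Module k F]
  {ι : Type*} (b : Module.Basis ι k M)

/-- The coefficient in `E` of an element of `M ⊗ E` at the `j`-th vector of a basis of `M`. -/
noncomputable def tensorCoord (E : Type*) [AddCommGroup E] [Module k E] (j : ι) :
    M ⊗[k] E →ₗ[k] E :=
  (TensorProduct.lid k E).toLinearMap ∘ₗ (b.coord j).rTensor E

theorem tensorCoord_tmul (j : ι) (m : M) (e : E) :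
    tensorCoord b E j (m ⊗ₜ e) = b.coord j m • e := by
  simp [tensorCoord]

theorem tensorCoord_lTensor (j : ι) (f : E →ₗ[k] F) (t : M ⊗[k] E) :
    tensorCoord b F j (f.lTensor M t) = f (tensorCoord b E j t) := by
  induction t using TensorProduct.induction_on with
  | zero => simp
  | tmul m e => simp only [LinearMap.lTensor_tmul, tensorCoord_tmul, map_smul]
  | add x y hx hy => simp only [map_add, hx, hy]

theorem sum_tmul_tensorCoord [Fintype ι] (t : M ⊗[k] E) :
    ∑ j, b j ⊗ₜ[k] tensorCoord b E j t = t := by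
  induction t using TensorProduct.induction_on with
  | zero => simp
  | tmul m e =>
    simp only [tensorCoord_tmul, TensorProduct.tmul_smul, TensorProduct.smul_tmul',
      ← TensorProduct.sum_tmul, Module.Basis.coord_apply, b.sum_repr]
  | add x y hx hy => simp only [map_add, TensorProduct.tmul_add, sum_add_distrib, hx, hy]

/-- A finite basis identifies `M ⊗ E` with `E^ι` and the image of `M ⊗ K` with `K^ι`. Membership in
a Lie subalgebra with coefficients thereby becomes a condition on single families. -/
theorem mem_range_lTensor_subtype_iff [Fintype ι] (K : Submodule k E) (t : M ⊗[k] E) :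
    t ∈ LinearMap.range (K.subtype.lTensor M) ↔ ∀ j, tensorCoord b E j t ∈ K := by
  constructor
  · rintro ⟨s, rfl⟩ j
    rw [tensorCoord_lTensor]
    exact Subtype.prop _
  · intro h
    refine ⟨∑ j, b j ⊗ₜ[k] ⟨_, h j⟩, ?_⟩
    simp only [map_sum, LinearMap.lTensor_tmul, Submodule.subtype_apply, sum_tmul_tensorCoord]

theorem lTensor_eq_zero_iff [Fintype ι] (f : E →ₗ[k] F) (t : M ⊗[k] E) :
    f.lTensor M t = 0 ↔ ∀ j, f (tensorCoord b E j t) = 0 := by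
  simp only [← tensorCoord_lTensor]
  constructor
  · intro h j
    rw [h, map_zero]
  · intro h
    rw [← sum_tmul_tensorCoord b (f.lTensor M t)]
    simp [h]

end Coordinates

/-! ### Tensors with coefficients in families -/

section Families

variable {k : Type*} [Field k] {W : Type*} [AddCommGroup W] [Module k W]
  {M : Type*} [AddCommGroup M] [Module k M]

/-- The operation `Wⁿ → M ⊗ W` of an element of `M ⊗ ∏ₙ Hom(Wⁿ, W)`, without signs. -/
noncomputable def tensorEval (n : ℕ) (t : M ⊗[k] Fam k W) :
    MultilinearMap k (fun _ : Fin n => W) (M ⊗[k] W) where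
  toFun x := (evalAt n x).lTensor M t
  map_update_add' := by
    intro _ x i y z
    have e : evalAt (k := k) n (Function.update x i (y + z)) =
        evalAt n (Function.update x i y) + evalAt n (Function.update x i z) := by
      ext g; exact (g n).map_update_add x i y z
    rw [e, LinearMap.lTensor_add, LinearMap.add_apply]
  map_update_smul' := by
    intro _ x i c y
    have e : evalAt (k := k) n (Function.update x i (c • y)) =
        c • evalAt n (Function.update x i y) := by
      ext g; exact (g n).map_update_smul x i c y
    rw [e, LinearMap.lTensor_smul, LinearMap.smul_apply]

theorem tensorEval_apply (n : ℕ) (t : M ⊗[k] Fam k W) (x : Fin n → W) :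
    tensorEval n t x = (evalAt n x).lTensor M t := rfl

theorem tensorEval_sum_tmul {ι : Type*} [Fintype ι] (n : ℕ) (e : ι → M) (g : ι → Fam k W)
    (x : Fin n → W) : tensorEval n (∑ a, e a ⊗ₜ[k] g a) x = ∑ a, e a ⊗ₜ[k] g a n x := by
  simp only [tensorEval_apply, map_sum, LinearMap.lTensor_tmul]
  rfl

theorem tensorEval_rTensor {M' : Type*} [AddCommGroup M'] [Module k M'] (φ : M →ₗ[k] M') (n : ℕ)
    (t : M ⊗[k] Fam k W) (x : Fin n → W) :
    tensorEval n (φ.rTensor _ t) x = φ.rTensor W (tensorEval n t x) :=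
  (rTensor_lTensor_comm φ (evalAt n x) t).symm

/-- An element of `M ⊗ ∏ₙ Hom(Wⁿ, W)` is determined by its operations, for finite-dimensional `M`. -/
theorem tensorEval_ext [Module.Finite k M] {s t : M ⊗[k] Fam k W}
    (h : ∀ n, tensorEval n s = tensorEval n t) : s = t := by
  let b := Module.finBasis k M
  rw [← sub_eq_zero]
  rw [← sum_tmul_tensorCoord b (s - t)]
  refine sum_eq_zero fun j _ => ?_
  have : tensorCoord b _ j (s - t) = 0 := by
    funext n
    ext x
    have h1 : (evalAt n x).lTensor M (s - t) = 0 := by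
      rw [map_sub, sub_eq_zero]
      exact congrArg (fun f => f x) (h n)
    exact (lTensor_eq_zero_iff b _ _).mp h1 j
  rw [this, TensorProduct.tmul_zero]

/-- Tensoring with a finite-dimensional space commutes with the infinite product over arities: the
coordinates of the given operations are the families to be used as coefficients. -/
theorem exists_tensorEval_eq [Module.Finite k M]
    (f : ∀ n, MultilinearMap k (fun _ : Fin n => W) (M ⊗[k] W)) :
    ∃ t : M ⊗[k] Fam k W, ∀ n, tensorEval n t = f n := by
  let b := Module.finBasis k M
  refine ⟨∑ j, b j ⊗ₜ[k] fun n => (tensorCoord b W j).compMultilinearMap (f n), fun n => ?_⟩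
  ext x
  rw [tensorEval_sum_tmul]
  exact sum_tmul_tensorCoord b (f n x)

theorem tensor_prod_ext {E F : Type*} [AddCommGroup E] [Module k E] [AddCommGroup F] [Module k F]
    {s t : M ⊗[k] (E × F)}
    (h1 : (LinearMap.fst k E F).lTensor M s = (LinearMap.fst k E F).lTensor M t)
    (h2 : (LinearMap.snd k E F).lTensor M s = (LinearMap.snd k E F).lTensor M t) : s = t := by
  have key : ∀ s : M ⊗[k] (E × F),
      s = (LinearMap.inl k E F).lTensor M ((LinearMap.fst k E F).lTensor M s) +
        (LinearMap.inr k E F).lTensor M ((LinearMap.snd k E F).lTensor M s) := fun s => by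
    simp only [← LinearMap.comp_apply, ← LinearMap.lTensor_comp]
    rw [← LinearMap.add_apply, ← LinearMap.lTensor_add]
    have : LinearMap.inl k E F ∘ₗ LinearMap.fst k E F + LinearMap.inr k E F ∘ₗ LinearMap.snd k E F =
        LinearMap.id := by ext <;> simp
    rw [this, LinearMap.lTensor_id, LinearMap.id_apply]
  rw [key s, key t, h1, h2]

theorem lTensor_fst_inl_add_inr {E F : Type*} [AddCommGroup E] [Module k E] [AddCommGroup F]
    [Module k F] (s : M ⊗[k] E) (t : M ⊗[k] F) : (LinearMap.fst k E F).lTensor M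
      ((LinearMap.inl k E F).lTensor M s + (LinearMap.inr k E F).lTensor M t) = s := by
  rw [map_add, ← LinearMap.lTensor_comp_apply, ← LinearMap.lTensor_comp_apply,
    LinearMap.fst_comp_inl, LinearMap.fst_comp_inr, LinearMap.lTensor_id, LinearMap.lTensor_zero,
    LinearMap.zero_apply, add_zero, LinearMap.id_apply]

theorem lTensor_snd_inl_add_inr {E F : Type*} [AddCommGroup E] [Module k E] [AddCommGroup F]
    [Module k F] (s : M ⊗[k] E) (t : M ⊗[k] F) : (LinearMap.snd k E F).lTensor M
      ((LinearMap.inl k E F).lTensor M s + (LinearMap.inr k E F).lTensor M t) = t := by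
  rw [map_add, ← LinearMap.lTensor_comp_apply, ← LinearMap.lTensor_comp_apply,
    LinearMap.snd_comp_inl, LinearMap.snd_comp_inr, LinearMap.lTensor_id, LinearMap.lTensor_zero,
    LinearMap.zero_apply, zero_add, LinearMap.id_apply]

end Families

/-! ### Homogeneous families -/

section HomFamilies

variable {k : Type*} [Field k] {W : Type*} [AddCommGroup W] [Module k W]
  {S : DGSpace k W}

theorem map_par_of_isHom {Y : Type*} [AddCommGroup Y] [Module k Y] {n : ℕ}
    (f : MultilinearMap k (fun _ : Fin n => W) Y) {x : Fin n → W} {q : Fin n → ZMod 2}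
    (hx : ∀ i, S.IsHom (q i) (x i)) : f (fun i => S.par (x i)) = sgn k (∑ i, q i) • f x := by
  have : (fun i => S.par (x i)) = fun i => sgn k (q i) • x i := funext fun i => hx i
  rw [this, MultilinearMap.map_smul_univ, sgn_sum]

variable [CharZero k]

theorem isHom_fam_apply {r : ZMod 2} {g : Fam k W} (hg : (famDG S).IsHom r g) {n : ℕ}
    {x : Fin n → W} {q : Fin n → ZMod 2} (hx : ∀ i, S.IsHom (q i) (x i)) :
    S.IsHom (r + ∑ i, q i) (g n x) := by
  have h1 : famPar S g = sgn k r • g := hg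
  have h2 : S.par (g n fun i => S.par (x i)) = sgn k r • g n x :=
    congrArg (fun f : Fam k W => f n x) h1
  rw [map_par_of_isHom _ hx, map_smul] at h2
  rw [DGSpace.IsHom, sgn_add, mul_comm, mul_smul, ← h2, sgn_smul_sgn_smul]

/-- The shift by `1` comes from `Π`. A coefficient of parity `p` in an even element thus accompanies
a vector field of parity `p + 1`, and the resulting operation is odd. -/
theorem extDG_isHom_iff {p : ZMod 2} {g : Fam k W} {w : W} :
    (extDG S).IsHom p (g, w) ↔ (famDG S).IsHom (p + 1) g ∧ S.IsHom p w := by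
  have h : (extDG S).par (g, w) = (-famPar S g, S.par w) := rfl
  have h' : (famDG S).par = famPar S := rfl
  rw [DGSpace.IsHom, DGSpace.IsHom, DGSpace.IsHom, h, h', Prod.smul_mk, Prod.mk.injEq, sgn_add,
    sgn_one, mul_neg_one, neg_smul, neg_eq_iff_eq_neg]

theorem bracket_apply_of_isHom (comp : Fam k W →ₗ[k] Fam k W →ₗ[k] Fam k W) {p q : ZMod 2}
    {g h : Fam k W} (hg : (famDG S).IsHom p g) (hh : (famDG S).IsHom q h) :
    bracket S comp g h = comp g h - sgn k (p * q) • comp h g := by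
  simp only [bracket, LinearMap.sub_apply, LinearMap.sum_apply, LinearMap.smul_apply,
    LinearMap.flip_apply, LinearMap.compl₁₂_apply, proj_of_isHom _ hg, proj_of_isHom _ hh]
  rw [sum_eq_single p, sum_eq_single q]
  · simp
  · intro b _ hb
    simp [hb]
  · simp
  · intro b _ hb
    simp [hb]
  · simp

end HomFamilies

/-! ### Extensions of scalars, evaluated at an even element -/

section EvenElement

variable {k : Type*} [Field k] {B : Type*} [Ring B] [Algebra k B]
  {W : Type*} [AddCommGroup W] [Module k W] {C : DGSpace k B} {S : DGSpace k W}

theorem oddExt_add {n : ℕ} (f g : MultilinearMap k (fun _ : Fin n => W) (B ⊗[k] W)) :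
    oddExt C S (f + g) = oddExt C S f + oddExt C S g := by
  ext x
  simp only [oddExt, map_add, _root_.sum_apply, smul_apply, MultilinearMap.compLinearMap_apply,
    add_apply, smul_add, sum_add_distrib]

theorem oddExt_zero {n : ℕ} :
    oddExt C S (0 : MultilinearMap k (fun _ : Fin n => W) (B ⊗[k] W)) = 0 := by
  ext x
  simp [oddExt]

theorem oddExt_sum {n : ℕ} {κ : Type*} (s : Finset κ)
    (f : κ → MultilinearMap k (fun _ : Fin n => W) (B ⊗[k] W)) :
    oddExt C S (∑ i ∈ s, f i) = ∑ i ∈ s, oddExt C S (f i) := by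
  classical
  induction s using Finset.induction_on with
  | empty => rw [sum_empty, sum_empty, oddExt_zero]
  | insert a s ha ih => rw [sum_insert ha, sum_insert ha, oddExt_add, ih]

variable [CharZero k] {ι : Type*} [Fintype ι] {p : ι → ZMod 2} {e : ι → B}

/-- Puts the exponent occurring in `actionOp` into the shape produced by `prod_ofFn_succAbove`, so
that the two signs can be compared. -/
theorem sum_Iio_eq_sum_ite {M : Type*} [AddCommMonoid M] {n : ℕ} (r : Fin (n + 1))
    (f : Fin (n + 1) → M) :
    ∑ j ∈ Iio r, f j = ∑ j, if r < r.succAbove j then 0 else f (r.succAbove j) := by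
  have : ∑ j ∈ Iio r, f j = ∑ j, if j < r then f j else 0 := by
    rw [← sum_filter]
    exact sum_congr (by ext; simp) fun _ _ => rfl
  rw [this, Fin.sum_univ_succAbove _ r, if_neg (lt_irrefl r), zero_add]
  refine sum_congr rfl fun j _ => ?_
  rcases lt_or_gt_of_ne (Fin.succAbove_ne r j) with h | h
  · simp [h, h.not_gt]
  · simp [h, h.not_gt]

/-- Since coefficient and vector have the same parity in each summand, the sign depends on the
parities `p` alone and is symmetric in the chosen indices. -/
theorem oddExt_sum_tmul {w : ι → W} (he : ∀ a, C.IsHom (p a) (e a))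
    (hw : ∀ a, S.IsHom (p a) (w a)) {n : ℕ}
    (f : MultilinearMap k (fun _ : Fin n => W) (B ⊗[k] W)) :
    oddExt C S f (fun _ => ∑ a, e a ⊗ₜ[k] w a) = ∑ α : Fin n → ι,
      sgn k (∑ i, p (α i) + ∑ i, ∑ j ∈ Ioi i, p (α i) * p (α j)) •
        ((List.ofFn fun i => e (α i)).prod • f fun i => w (α i)) := by
  classical
  rw [MultilinearMap.map_sum]
  exact sum_congr rfl fun α _ => oddExt_tmul C S f _ _ _ _ (fun i => he _) fun i => hw _

/-- On an even element the Koszul sign of permuting the vectors cancels that of permuting the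
coefficients, because the parities agree. The remaining sign of `oddExt` is a symmetric function of
the parities and does not change. -/
theorem oddExt_twist_domDomCongr
    (hcomm : ∀ p q a b, C.IsHom p a → C.IsHom q b → a * b = sgn k (p * q) • (b * a)) {n : ℕ}
    (f : MultilinearMap k (fun _ : Fin n => W) (B ⊗[k] W)) (σ : Equiv.Perm (Fin n))
    {ξ : B ⊗[k] W} (hξ : (C.tensor S).par ξ = ξ) :
    oddExt C S (twist S (fun p => sgn k (∑ i, ∑ j ∈ Ioi i, if σ j < σ i then p (σ i) * p (σ j) else 0))
      (f.domDomCongr σ)) (fun _ => ξ) = oddExt C S f fun _ => ξ := by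
  obtain ⟨m, p, e, w, he, hw, rfl⟩ := exists_sum_tmul_isHom C S ξ hξ
  rw [oddExt_sum_tmul he hw, oddExt_sum_tmul he hw]
  -- Replaces each choice of summands `α` by `α ∘ σ`, so that both sides evaluate `f` at the same
  -- vectors.
  conv_rhs => rw [← Equiv.sum_comp (Equiv.arrowCongr σ.symm (Equiv.refl (Fin m)))]
  refine sum_congr rfl fun α _ => ?_
  rw [twist_apply S _ _ _ (fun i => p (α i)) fun i => hw _, MultilinearMap.domDomCongr_apply,
    prod_ofFn_perm hcomm σ (b := fun i => e (α i)) (p := fun i => p (α i)) fun i => he _]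
  simp only [Equiv.arrowCongr_apply, Equiv.coe_refl, Equiv.symm_symm, Function.comp_apply, id]
  rw [Equiv.sum_comp σ fun i => p (α i),
    sum_Ioi_perm σ (fun i j => p (α i) * p (α j)) fun i j => mul_comm _ _, smul_assoc,
    smul_comm (List.ofFn _).prod, sgn_smul_sgn_smul]

/-- At fixed homogeneous arguments, symmetrizing and then evaluating is a linear combination of
evaluations, and linear combinations commute with tensoring by coefficients. -/
theorem tensorEval_symmetrize {M : Type*} [AddCommGroup M] [Module k M] (n : ℕ)
    (t : M ⊗[k] Fam k W) :
    tensorEval n ((symmetrize S).lTensor M t) = ∑ σ : Equiv.Perm (Fin n),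
      twist S (fun p => sgn k (∑ i, ∑ j ∈ Ioi i, if σ j < σ i then p (σ i) * p (σ j) else 0))
        ((tensorEval n t).domDomCongr σ) := by
  refine multilinear_ext_isHom S fun x p hx => ?_
  have h : evalAt n x ∘ₗ symmetrize S = ∑ σ : Equiv.Perm (Fin n),
      sgn k (∑ i, ∑ j ∈ Ioi i, if σ j < σ i then p (σ i) * p (σ j) else 0) •
        evalAt (k := k) n fun i => x (σ i) := by
    ext g
    rw [LinearMap.comp_apply, LinearMap.sum_apply]
    change (∑ σ : Equiv.Perm (Fin n), _ : MultilinearMap k (fun _ : Fin n => W) W) x = _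
    rw [_root_.sum_apply]
    refine sum_congr rfl fun σ _ => ?_
    rw [twist_apply S _ _ _ p hx]
    rfl
  rw [tensorEval_apply, ← LinearMap.comp_apply, ← LinearMap.lTensor_comp, h, _root_.sum_apply]
  simp only [twist_apply S _ _ x p hx, MultilinearMap.domDomCongr_apply, tensorEval_apply]
  simp only [← LinearMap.coe_lTensorHom, map_sum, map_smul, LinearMap.sum_apply,
    LinearMap.smul_apply]

/-- All `n!` permutations contribute the same value. This factor accounts for the difference between
the Maurer–Cartan series of `L∞` and of `A∞` algebras. -/
theorem oddExt_symmetrize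
    (hcomm : ∀ p q a b, C.IsHom p a → C.IsHom q b → a * b = sgn k (p * q) • (b * a)) (n : ℕ)
    (t : B ⊗[k] Fam k W) {ξ : B ⊗[k] W} (hξ : (C.tensor S).par ξ = ξ) :
    oddExt C S (tensorEval n ((symmetrize S).lTensor B t)) (fun _ => ξ) =
      (n.factorial : k) • oddExt C S (tensorEval n t) fun _ => ξ := by
  rw [tensorEval_symmetrize, oddExt_sum, _root_.sum_apply]
  simp only [oddExt_twist_domDomCongr hcomm _ _ hξ, sum_const, card_univ, Fintype.card_perm,
    Fintype.card_fin, Nat.cast_smul_eq_nsmul]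

theorem actionOp_succ_apply (ρ : Fam k W →ₗ[k] Fam k W) {n : ℕ} {x : Fin (n + 1) → Fam k W × W}
    {q : Fin (n + 1) → ZMod 2} (hx : ∀ i, (extDG S).IsHom (q i) (x i)) :
    actionOp S ρ (n + 1) x = ∑ i, sgn k (q i * ∑ j ∈ Iio i, q j) •
      ((0 : Fam k W), ρ (x i).1 n fun j => (x (i.succAbove j)).2) := by
  rw [actionOp, _root_.sum_apply]
  refine sum_congr rfl fun i _ => ?_
  rw [twist_apply _ _ _ _ q hx]
  rfl

/-- Every slot receives the same even element, so each position of the vector field gives the same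
contribution. Moving its coefficient `e c` to the front leaves the sign `(-1)^(p c)`, which is
exactly the sign relating `ζ` to its operations. -/
theorem oddExt_actionOp (hmul : ∀ a b, C.par (a * b) = C.par a * C.par b)
    (hcomm : ∀ p q a b, C.IsHom p a → C.IsHom q b → a * b = sgn k (p * q) • (b * a))
    (ρ : Fam k W →ₗ[k] Fam k W) {g : ι → Fam k W} {w : ι → W} (he : ∀ a, C.IsHom (p a) (e a))
    (hz : ∀ a, (extDG S).IsHom (p a) (g a, w a)) (n : ℕ) :
    oddExt C (extDG S) ((TensorProduct.mk k B _ 1).compMultilinearMap (actionOp S ρ (n + 1)))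
        (fun _ => ∑ a, e a ⊗ₜ[k] (g a, w a)) =
      ((n + 1 : ℕ) : k) • (LinearMap.inr k (Fam k W) W).lTensor B
        (oddExt C S (tensorEval n (∑ a, (sgn k (p a) • e a) ⊗ₜ[k] ρ (g a)))
          fun _ => ∑ a, e a ⊗ₜ[k] w a) := by
  rw [oddExt_sum_tmul he hz, oddExt_sum_tmul he fun a => (extDG_isHom_iff.mp (hz a)).2]
  simp only [LinearMap.compMultilinearMap_apply, actionOp_succ_apply ρ fun i => hz _, map_sum,
    smul_sum]
  rw [sum_comm, ← smul_sum, Nat.cast_smul_eq_nsmul]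
  refine (sum_congr rfl fun i _ => ?_).trans ((sum_const _).trans (by
    rw [card_univ, Fintype.card_fin]))
  -- A choice of summands for all slots is a choice `c` for the slot of the vector field and a
  -- choice `β` for the others.
  rw [← Equiv.sum_comp (Fin.insertNthEquiv (fun _ => ι) i), Fintype.sum_prod_type, sum_comm]
  refine sum_congr rfl fun β _ => ?_
  rw [tensorEval_sum_tmul]
  simp only [map_sum, smul_sum, map_smul]
  refine sum_congr rfl fun c _ => ?_
  have hα : (Fin.insertNthEquiv (fun _ => ι) i) (c, β) = i.insertNth c β := rfl
  have hIoi := sum_Ioi_succAbove i fun j l =>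
    p (i.insertNth (α := fun _ => ι) c β j) * p (i.insertNth (α := fun _ => ι) c β l)
  have hprod := prod_ofFn_succAbove hcomm i (b := fun j => e (i.insertNth (α := fun _ => ι) c β j))
    (p := fun j => p (i.insertNth (α := fun _ => ι) c β j)) fun j => he _
  have hsum := Fin.sum_univ_succAbove (fun j => p (i.insertNth (α := fun _ => ι) c β j)) i
  have hIio := sum_Iio_eq_sum_ite i fun j => p (i.insertNth (α := fun _ => ι) c β j)
  simp only [Fin.insertNth_apply_same, Fin.insertNth_apply_succAbove] at hIoi hprod hsum hIio
  have hpair : ∑ j, (if i < i.succAbove j then p c * p (β j) else p (β j) * p c) =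
      p c * ∑ j, p (β j) := by
    rw [mul_sum]
    exact sum_congr rfl fun j _ => by split_ifs; exacts [rfl, mul_comm _ _]
  rw [hα, hIoi, hprod, hsum, hIio, hpair]
  simp only [Fin.insertNth_apply_same, Fin.insertNth_apply_succAbove]
  have hc : (List.ofFn fun j => e (β j)).prod * e c =
      sgn k (p c * ∑ j, p (β j)) • (e c * (List.ofFn fun j => e (β j)).prod) := by
    rw [mul_comm (p c)]
    exact hcomm _ _ _ _ (isHom_prod_ofFn hmul fun j => he (β j)) (he c)
  simp only [TensorProduct.mk_apply, TensorProduct.smul_tmul', smul_eq_mul, mul_one,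
    LinearMap.lTensor_tmul, LinearMap.inr_apply, mul_smul_comm, hc, smul_smul, ← sgn_add]
  -- The cost of bringing `e c` to the front of the product equals the sign built into `actionOp`,
  -- so the two cancel.
  congr 3
  rw [CharTwo.add_self_eq_zero]
  ring

end EvenElement

/-! ### The quadratic terms of the Maurer–Cartan equation and of the structure identities -/

section Quadratic

variable {k : Type*} [Field k] {B : Type*} [Ring B] [Algebra k B]
  {W : Type*} [AddCommGroup W] [Module k W] {ι : Type*} [Fintype ι] {p : ι → ZMod 2} {e : ι → B}

/-- The composition `∑ ± e_a e_b ⊗ g_a ⋆ g_b` of the family of operations with coefficients in `B`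
given by `∑ e_a ⊗ g_a`. -/
noncomputable def tensorComp (comp : Fam k W →ₗ[k] Fam k W →ₗ[k] Fam k W) (p : ι → ZMod 2)
    (e : ι → B) (g : ι → Fam k W) : B ⊗[k] Fam k W :=
  ∑ a, ∑ b, sgn k (p a + p a * p b) • (e a * e b) ⊗ₜ[k] comp (g a) (g b)

theorem tensorEval_tensorComp (comp : Fam k W →ₗ[k] Fam k W →ₗ[k] Fam k W) (g : ι → Fam k W)
    (n : ℕ) (x : Fin n → W) : tensorEval n (tensorComp comp p e g) x =
      ∑ a, ∑ b, (sgn k (p a + p a * p b) • (e a * e b)) ⊗ₜ[k] comp (g a) (g b) n x := by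
  simp only [tensorComp, TensorProduct.smul_tmul', tensorEval_apply, map_sum,
    LinearMap.lTensor_tmul]
  rfl

variable [CharZero k] {C : DGSpace k B} {S : DGSpace k W}

/-- The summand for `(a, b)` is a composition plus its transpose: commuting `e_a` with `e_b` turns
the second half of the graded commutator into the first half of the summand for `(b, a)`. Hence the
factor `2`. -/
theorem oddExt_bracketOp
    (hmul : ∀ a b, C.par (a * b) = C.par a * C.par b)
    (hcomm : ∀ p q a b, C.IsHom p a → C.IsHom q b → a * b = sgn k (p * q) • (b * a))
    (comp : Fam k W →ₗ[k] Fam k W →ₗ[k] Fam k W) {g : ι → Fam k W} {w : ι → W}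
    (he : ∀ a, C.IsHom (p a) (e a)) (hz : ∀ a, (extDG S).IsHom (p a) (g a, w a)) :
    oddExt C (extDG S) ((TensorProduct.mk k B _ 1).compMultilinearMap
        (bracketOp S (bracket S comp) 2)) (fun _ => ∑ a, e a ⊗ₜ[k] (g a, w a)) =
      -((2 : k) • (LinearMap.inl k (Fam k W) W).lTensor B
        (C.par.rTensor _ (tensorComp comp p e g))) := by
  have hg : ∀ a, (famDG S).IsHom (p a + 1) (g a) := fun a => (extDG_isHom_iff.mp (hz a)).1
  have hpar : ∀ a, famPar S (g a) = sgn k (p a + 1) • g a := hg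
  rw [oddExt_sum_tmul he hz, ← Equiv.sum_comp (finTwoArrowEquiv ι).symm, Fintype.sum_prod_type]
  have h1 : ∀ a b, C.par (e a * e b) = sgn k (p a + p b) • (e a * e b) :=
    fun a b => isHom_mul hmul (he a) (he b)
  have h2 : ∀ a b, bracket S comp (famPar S (g a)) (g b) =
      sgn k (p a + 1) • (comp (g a) (g b) - sgn k ((p a + 1) * (p b + 1)) • comp (g b) (g a)) := by
    intro a b
    rw [hpar, map_smul, LinearMap.smul_apply, bracket_apply_of_isHom comp (hg a) (hg b)]
  -- The exponent is that of `tensorComp` plus the parity `p a + p b` of `e a * e b`, contributed by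
  -- `C.par`; the two occurrences of `p a` cancel.
  set F : ι → ι → B ⊗[k] (Fam k W × W) := fun a b =>
    sgn k (p b + p a * p b) • (e a * e b) ⊗ₜ[k] (comp (g a) (g b), (0 : W)) with hF
  have h3 : (LinearMap.inl k (Fam k W) W).lTensor B (C.par.rTensor _ (tensorComp comp p e g)) =
      ∑ a, ∑ b, F a b := by
    simp only [tensorComp, map_sum, map_smul, LinearMap.rTensor_tmul, h1, LinearMap.lTensor_tmul,
      LinearMap.inl_apply, ← TensorProduct.smul_tmul', smul_smul, ← sgn_add]
    refine sum_congr rfl fun a _ => sum_congr rfl fun b _ => ?_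
    rw [hF]
    congr 2
    linear_combination CharTwo.add_self_eq_zero (p a)
  rw [h3]
  have h4 : ∀ a b, sgn k (∑ i, p (![a, b] i) + ∑ i, ∑ j ∈ Ioi i, p (![a, b] i) * p (![a, b] j)) •
      (List.ofFn fun i => e (![a, b] i)).prod •
        (1 : B) ⊗ₜ[k] (bracket S comp (famPar S (g a)) (g b), (0 : W)) = -F a b - F b a := by
    intro a b
    have h5 : (1 : B) ⊗ₜ[k] (bracket S comp (famPar S (g a)) (g b), (0 : W)) =
        sgn k (p a + 1) • (1 ⊗ₜ[k] (comp (g a) (g b), (0 : W)) -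
          sgn k ((p a + 1) * (p b + 1)) • 1 ⊗ₜ[k] (comp (g b) (g a), (0 : W))) := by
      rw [← TensorProduct.tmul_smul, ← TensorProduct.tmul_sub, ← TensorProduct.tmul_smul, h2]
      simp
    have h6 : ∑ i, ∑ j ∈ Ioi i, p (![a, b] i) * p (![a, b] j) = p a * p b := by
      simp [sum_Ioi_eq_sum_ite, Fin.sum_univ_two]
    have h7 : (List.ofFn fun i => e (![a, b] i)).prod = e a * e b := by
      simp [List.ofFn_succ]
    rw [h5, h6, h7, Fin.sum_univ_two, smul_comm (e a * e b), smul_sub, smul_comm (e a * e b),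
      TensorProduct.smul_tmul', TensorProduct.smul_tmul', smul_eq_mul, mul_one]
    simp only [hF, hcomm _ _ _ _ (he b) (he a), ← TensorProduct.smul_tmul', Matrix.cons_val_zero,
      Matrix.cons_val_one]
    generalize (e a * e b) ⊗ₜ[k] (comp (g a) (g b), (0 : W)) = X
    generalize (e a * e b) ⊗ₜ[k] (comp (g b) (g a), (0 : W)) = Y
    have h11 : (1 + 1 : ZMod 2) = 0 := rfl
    rcases zmod_two_cases (p a) with ha | ha <;> rcases zmod_two_cases (p b) with hb | hb <;>
      simp only [ha, hb, h11, add_zero, zero_add, mul_zero, mul_one, sgn_zero, sgn_one] <;> module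
  have h8 : ∀ a b, (TensorProduct.mk k B _ 1).compMultilinearMap (bracketOp S (bracket S comp) 2)
      (fun i => (g (![a, b] i), w (![a, b] i))) =
        1 ⊗ₜ[k] (bracket S comp (famPar S (g a)) (g b), (0 : W)) := fun a b => by
    rw [LinearMap.compMultilinearMap_apply, bracketOp_two]
    rfl
  refine (sum_congr rfl fun a _ => sum_congr rfl fun b _ =>
    (congrArg _ (congrArg _ (h8 a b))).trans (h4 a b)).trans ?_
  simp only [sum_sub_distrib, sum_neg_distrib]
  rw [sum_comm (f := fun a b => F b a), two_smul]
  abel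

/-- The coefficient `e b` passes the arguments in front of the slot `r` and then `e a`, which gives
the two signs. The sign of `e b` in the operation cancels the one due to the oddness of the outer
operation. The parity `r'` of the inserted value does not appear, since only coefficients `1` stand
to its right. -/
theorem oddExt_insertNth
    (hmul : ∀ a b, C.par (a * b) = C.par a * C.par b)
    (hcomm : ∀ p q a b, C.IsHom p a → C.IsHom q b → a * b = sgn k (p * q) • (b * a))
    (he : ∀ a, C.IsHom (p a) (e a)) (g : ι → Fam k W) {n : ℕ} (r : Fin (n + 1)) {y : ι → W}
    {r' : ι → ZMod 2} (hy : ∀ a, S.IsHom (r' a) (y a)) {x : Fin n → W} {q : Fin n → ZMod 2}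
    (hx : ∀ i, S.IsHom (q i) (x i)) :
    oddExt C S (tensorEval (n + 1) (∑ a, (sgn k (p a) • e a) ⊗ₜ[k] g a))
        (r.insertNth (∑ b, (sgn k (p b) • e b) ⊗ₜ[k] y b) fun i => (1 : B) ⊗ₜ[k] x i) =
      ∑ a, ∑ b, sgn k (p b * ∑ j, if r < r.succAbove j then 0 else q j) •
        sgn k (p a + p a * p b) • (e a * e b) ⊗ₜ[k] g a (n + 1) (r.insertNth (y b) x) := by
  have key : ∀ b, oddExt C S (tensorEval (n + 1) (∑ a, (sgn k (p a) • e a) ⊗ₜ[k] g a))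
        (r.insertNth (e b ⊗ₜ[k] y b) fun i => (1 : B) ⊗ₜ[k] x i) =
      ∑ a, sgn k (p b) • sgn k (p b * ∑ j, if r < r.succAbove j then 0 else q j) •
        sgn k (p a + p a * p b) • (e a * e b) ⊗ₜ[k] g a (n + 1) (r.insertNth (y b) x) := by
    intro b
    have h1 : (r.insertNth (e b ⊗ₜ[k] y b) fun i => (1 : B) ⊗ₜ[k] x i : Fin (n + 1) → B ⊗[k] W) =
        fun i => (r.insertNth (e b) fun _ => 1 : Fin (n + 1) → B) i ⊗ₜ[k]
          (r.insertNth (y b) x : Fin (n + 1) → W) i := by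
      refine Fin.insertNth_eq_iff.mpr ⟨by simp, ?_⟩
      funext i
      simp [Fin.removeNth]
    have hb : ∀ i, C.IsHom ((r.insertNth (p b) fun _ => 0 : Fin (n + 1) → ZMod 2) i)
        ((r.insertNth (e b) fun _ => 1 : Fin (n + 1) → B) i) := by
      intro i
      refine Fin.succAboveCases r ?_ (fun j => ?_) i
      · simpa using he b
      · simpa using isHom_one hmul
    have hw : ∀ i, S.IsHom ((r.insertNth (r' b) q : Fin (n + 1) → ZMod 2) i)
        ((r.insertNth (y b) x : Fin (n + 1) → W) i) := by
      intro i
      refine Fin.succAboveCases r ?_ (fun j => ?_) i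
      · simpa using hy b
      · simpa using hx j
    have hprod := prod_ofFn_succAbove hcomm r hb
    simp only [Fin.insertNth_apply_same, Fin.insertNth_apply_succAbove, ite_self, sum_const_zero,
      mul_zero, sgn_zero, one_smul, List.ofFn_const, List.prod_replicate, one_pow, mul_one] at hprod
    rw [h1, oddExt_tmul C S _ _ _ _ _ hb hw, hprod, sum_Ioi_succAbove r, Fin.sum_univ_succAbove _ r,
      tensorEval_sum_tmul]
    simp only [Fin.insertNth_apply_same, Fin.insertNth_apply_succAbove, sum_const_zero, mul_zero,
      add_zero]
    have hs : ∑ j, (if r < r.succAbove j then 0 else q j * p b) =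
        p b * ∑ j, if r < r.succAbove j then 0 else q j := by
      rw [mul_sum]
      exact sum_congr rfl fun j _ => by split_ifs; exacts [(mul_zero _).symm, mul_comm _ _]
    rw [hs, smul_sum, smul_sum]
    refine sum_congr rfl fun a _ => ?_
    rw [TensorProduct.smul_tmul', smul_eq_mul, mul_smul_comm, hcomm _ _ _ _ (he b) (he a)]
    simp only [← TensorProduct.smul_tmul', smul_smul, ← sgn_add]
    congr 2
    ring
  -- Linearity in the slot `r` reduces the sum over `b` to the single inserted tensors treated in
  -- `key`.
  rw [sum_comm, ← MultilinearMap.curryMid_apply_apply, map_sum, _root_.sum_apply]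
  refine sum_congr rfl fun b _ => ?_
  rw [← TensorProduct.smul_tmul', map_smul, smul_apply, MultilinearMap.curryMid_apply_apply, key, smul_sum]
  exact sum_congr rfl fun a _ => sgn_smul_sgn_smul (k := k) (p b) _

end Quadratic

/-! ### The structure identities in terms of compositions of families -/

section Identities

variable {k : Type*} [Field k] [CharZero k] {B : Type*} [Ring B] [Algebra k B]
  {W : Type*} [AddCommGroup W] [Module k W] {C : DGSpace k B} {S : DGSpace k W}
  {ι : Type*} [Fintype ι] {p : ι → ZMod 2} {e : ι → B}

theorem lieComp_apply_of_isHom (g h : Fam k W) {n : ℕ} {x : Fin n → W} {q : Fin n → ZMod 2}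
    (hx : ∀ i, S.IsHom (q i) (x i)) :
    lieComp S g h n x = ∑ s : Finset (Fin n) with s.Nonempty, shuffleSgn k s q •
      g (#sᶜ + 1) ((0 : Fin (#sᶜ + 1)).insertNth (h #s (x ∘ s.orderEmbOfFin rfl))
        (x ∘ sᶜ.orderEmbOfFin rfl)) := by
  rw [lieComp, LinearMap.mk₂_apply, _root_.sum_apply]
  exact sum_congr rfl fun s _ => by rw [twist_apply S _ _ _ q hx, insertAt_apply]

theorem assComp_apply_of_isHom (g : Fam k W) {h : Fam k W} {r : ZMod 2} (hh : (famDG S).IsHom r h)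
    {n : ℕ} {x : Fin n → W} {q : Fin n → ZMod 2} (hx : ∀ i, S.IsHom (q i) (x i)) :
    assComp S g h n x = ∑ a : Fin n, ∑ b ∈ Ici a, sgn k (r * ∑ i ∈ Iio a, q i) •
      g (#(Icc a b)ᶜ + 1) ((slot a b).insertNth (h #(Icc a b) (x ∘ (Icc a b).orderEmbOfFin rfl))
        (x ∘ (Icc a b)ᶜ.orderEmbOfFin rfl)) := by
  rw [assComp, LinearMap.mk₂_apply]
  simp only [_root_.sum_apply, twist_apply S _ _ _ q hx, insertAt_apply, proj_of_isHom _ hh]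
  refine sum_congr rfl fun a _ => sum_congr rfl fun b _ => ?_
  rw [sum_eq_single r]
  · simp
  · intro r' _ hr'
    rw [(g _).map_coord_zero (slot a b) (by simp [hr']), smul_zero]
  · simp

theorem oddExt_insertNth_tensorEval
    (hmul : ∀ a b, C.par (a * b) = C.par a * C.par b)
    (hcomm : ∀ p q a b, C.IsHom p a → C.IsHom q b → a * b = sgn k (p * q) • (b * a))
    (he : ∀ a, C.IsHom (p a) (e a)) {g : ι → Fam k W} (hg : ∀ a, (famDG S).IsHom (p a + 1) (g a))
    {n : ℕ} {x : Fin n → W} {q : Fin n → ZMod 2} (hx : ∀ i, S.IsHom (q i) (x i))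
    (s : Finset (Fin n)) (r : Fin (#sᶜ + 1)) :
    oddExt C S (tensorEval (#sᶜ + 1) (∑ a, (sgn k (p a) • e a) ⊗ₜ[k] g a))
        (r.insertNth
          (tensorEval #s (∑ a, (sgn k (p a) • e a) ⊗ₜ[k] g a) (x ∘ s.orderEmbOfFin rfl))
          (fun i => (1 : B) ⊗ₜ[k] x (sᶜ.orderEmbOfFin rfl i))) =
      ∑ a, ∑ b, sgn k (p b * ∑ j, if r < r.succAbove j then 0 else q (sᶜ.orderEmbOfFin rfl j)) •
        sgn k (p a + p a * p b) • (e a * e b) ⊗ₜ[k] g a (#sᶜ + 1)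
          (r.insertNth (g b #s (x ∘ s.orderEmbOfFin rfl)) (x ∘ sᶜ.orderEmbOfFin rfl)) := by
  rw [tensorEval_sum_tmul]
  exact oddExt_insertNth hmul hcomm he g r
    (y := fun b => g b #s (x ∘ s.orderEmbOfFin rfl)) (x := x ∘ sᶜ.orderEmbOfFin rfl)
    (fun b => isHom_fam_apply (hg b) fun i => hx _) fun i => hx _

/-- The inner operation goes into slot `0`, so its coefficient passes no arguments and only the
shuffle signs remain, on both sides. -/
theorem lie_quadratic
    (hmul : ∀ a b, C.par (a * b) = C.par a * C.par b)
    (hcomm : ∀ p q a b, C.IsHom p a → C.IsHom q b → a * b = sgn k (p * q) • (b * a))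
    (he : ∀ a, C.IsHom (p a) (e a)) {g : ι → Fam k W} (hg : ∀ a, (famDG S).IsHom (p a + 1) (g a))
    {n : ℕ} {x : Fin n → W} {q : Fin n → ZMod 2} (hx : ∀ i, S.IsHom (q i) (x i)) :
    (∑ s : Finset (Fin n) with s.Nonempty, shuffleSgn k s q •
        oddExt C S (tensorEval (#sᶜ + 1) (∑ a, (sgn k (p a) • e a) ⊗ₜ[k] g a))
          ((0 : Fin (#sᶜ + 1)).insertNth
            (tensorEval #s (∑ a, (sgn k (p a) • e a) ⊗ₜ[k] g a) (x ∘ s.orderEmbOfFin rfl))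
            (fun i => (1 : B) ⊗ₜ[k] x (sᶜ.orderEmbOfFin rfl i)))) =
      tensorEval n (tensorComp (lieComp S) p e g) x := by
  rw [tensorEval_tensorComp]
  simp only [lieComp_apply_of_isHom _ _ hx, TensorProduct.tmul_sum]
  simp only [sum_comm (s := (univ : Finset ι)) (t := univ.filter fun s : Finset (Fin n) => s.Nonempty)]
  refine sum_congr rfl fun s _ => ?_
  rw [oddExt_insertNth_tensorEval hmul hcomm he hg hx, smul_sum]
  refine sum_congr rfl fun a _ => ?_
  rw [smul_sum]
  refine sum_congr rfl fun b _ => ?_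
  simp only [Fin.zero_succAbove, Fin.succ_pos, if_true, sum_const_zero, mul_zero, sgn_zero,
    one_smul, TensorProduct.tmul_smul, TensorProduct.smul_tmul']

/-- Exactly `i` elements of `t` lie below its element number `i`; comparison with `a` becomes
comparison of ranks. -/
theorem orderEmbOfFin_lt_iff {n : ℕ} (t : Finset (Fin n)) (a : Fin n) (i : Fin #t) :
    t.orderEmbOfFin rfl i < a ↔ (i : ℕ) < #{c ∈ t | c < a} := by
  have h : #{c ∈ t | c < t.orderEmbOfFin rfl i} = i := by
    have : {c ∈ t | c < t.orderEmbOfFin rfl i} =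
        (Iio i).map (t.orderEmbOfFin rfl).toEmbedding := by
      ext c
      simp only [mem_filter, Finset.mem_map, mem_Iio, RelEmbedding.coe_toEmbedding]
      constructor
      · rintro ⟨hc, hlt⟩
        obtain ⟨j, rfl⟩ : c ∈ Set.range (t.orderEmbOfFin rfl) := by
          rw [range_orderEmbOfFin]; exact hc
        exact ⟨j, (OrderEmbedding.lt_iff_lt _).mp hlt, rfl⟩
      · rintro ⟨j, hj, rfl⟩
        exact ⟨orderEmbOfFin_mem t rfl j, (OrderEmbedding.lt_iff_lt _).mpr hj⟩
    rw [this, card_map, Fin.card_Iio]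
  constructor
  · intro hlt
    calc (i : ℕ) = #{c ∈ t | c < t.orderEmbOfFin rfl i} := h.symm
      _ < #{c ∈ t | c < a} := by
        refine card_lt_card ⟨fun c hc => ?_, fun hsub => ?_⟩
        · rw [mem_filter] at hc ⊢
          exact ⟨hc.1, hc.2.trans hlt⟩
        · have := hsub (mem_filter.mpr ⟨orderEmbOfFin_mem t rfl i, hlt⟩)
          exact lt_irrefl _ (mem_filter.mp this).2
  · intro hlt
    by_contra hge
    rw [not_lt] at hge
    refine hlt.not_ge ?_
    calc #{c ∈ t | c < a} ≤ #{c ∈ t | c < t.orderEmbOfFin rfl i} :=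
          card_le_card fun c hc => by
            rw [mem_filter] at hc ⊢
            exact ⟨hc.1, hc.2.trans_le hge⟩
      _ = i := h

/-- The arguments in front of the inserted value are those with index below `a`, which is what the
definition of `slot` by counting encodes. -/
theorem sum_lt_slot {M : Type*} [AddCommMonoid M] {n : ℕ} (a b : Fin n) (f : Fin n → M) :
    ∑ j, (if slot a b < (slot a b).succAbove j then 0 else f ((Icc a b)ᶜ.orderEmbOfFin rfl j)) =
      ∑ i ∈ Iio a, f i := by
  have h1 : ∀ j, (slot a b < (slot a b).succAbove j) ↔
      ¬ (Icc a b)ᶜ.orderEmbOfFin rfl j < a := fun j => by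
    rw [Fin.lt_succAbove_iff_le_castSucc, orderEmbOfFin_lt_iff, not_lt]
    rfl
  have h2 : Iio a = {i ∈ (Icc a b)ᶜ | i < a} := by
    ext i
    simp only [mem_Iio, mem_filter, mem_compl, mem_Icc, not_and, not_le]
    exact ⟨fun h => ⟨fun h' => absurd h h'.not_gt, h⟩, fun h => h.2⟩
  simp only [h1, ite_not]
  rw [h2, sum_filter, ← sum_coe_sort (Icc a b)ᶜ fun i => if i < a then f i else 0]
  exact Fintype.sum_equiv ((Icc a b)ᶜ.orderIsoOfFin rfl).toEquiv _ _ fun j => rfl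

/-- The `A∞` identity contributes the sign of an odd operation passing the preceding arguments, and
the coefficient `e_b` contributes another factor with exponent `p_b`. Together they are the sign in
`assComp` for a vector field of parity `p_b + 1`. -/
theorem ass_quadratic
    (hmul : ∀ a b, C.par (a * b) = C.par a * C.par b)
    (hcomm : ∀ p q a b, C.IsHom p a → C.IsHom q b → a * b = sgn k (p * q) • (b * a))
    (he : ∀ a, C.IsHom (p a) (e a)) {g : ι → Fam k W} (hg : ∀ a, (famDG S).IsHom (p a + 1) (g a))
    {n : ℕ} {x : Fin n → W} {q : Fin n → ZMod 2} (hx : ∀ i, S.IsHom (q i) (x i)) :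
    (∑ a : Fin n, ∑ b ∈ Ici a, sgn k (∑ i ∈ Iio a, q i) •
        oddExt C S (tensorEval (#(Icc a b)ᶜ + 1) (∑ a, (sgn k (p a) • e a) ⊗ₜ[k] g a))
          ((slot a b).insertNth
            (tensorEval #(Icc a b) (∑ a, (sgn k (p a) • e a) ⊗ₜ[k] g a)
              (x ∘ (Icc a b).orderEmbOfFin rfl))
            (fun i => (1 : B) ⊗ₜ[k] x ((Icc a b)ᶜ.orderEmbOfFin rfl i)))) =
      tensorEval n (tensorComp (assComp S) p e g) x := by
  rw [tensorEval_tensorComp, sum_sigma' (s := univ) (t := fun a : Fin n => Ici a)]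
  simp only [assComp_apply_of_isHom _ (hg _) hx, TensorProduct.tmul_sum]
  simp only [sum_sigma' (s := univ) (t := fun a : Fin n => Ici a)]
  simp only [sum_comm (s := (univ : Finset ι)) (t := univ.sigma fun a : Fin n => Ici a)]
  refine sum_congr rfl fun s _ => ?_
  rw [oddExt_insertNth_tensorEval hmul hcomm he hg hx, smul_sum]
  refine sum_congr rfl fun a _ => ?_
  rw [smul_sum]
  refine sum_congr rfl fun b _ => ?_
  rw [sum_lt_slot]
  simp only [TensorProduct.tmul_smul, TensorProduct.smul_tmul', smul_smul, ← sgn_add]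
  congr 3
  ring

/-- The differential of `Π𝔥` is minus that of `𝔥`, and `C.par` is the sign in the passage from `Π𝔥`
to operations; applied after the odd differential instead of before it, it produces the overall
minus sign. -/
theorem diffOdd_tensorEval (he : ∀ a, C.IsHom (p a) (e a)) {g : ι → Fam k W}
    (hg : ∀ a, (famDG S).IsHom (p a + 1) (g a)) {n : ℕ} {x : Fin n → W} {q : Fin n → ZMod 2}
    (hx : ∀ i, S.IsHom (q i) (x i)) :
    diffOdd C S (tensorEval n (∑ a, (sgn k (p a) • e a) ⊗ₜ[k] g a)) x q =
      -tensorEval n (C.par.rTensor _ ((C.tensor (famDG S).shift).d (∑ a, e a ⊗ₜ[k] g a))) x := by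
  have hpre : ∀ a, famPre S (famPar S (g a)) n x = sgn k (p a + 1) •
      ∑ i, sgn k (∑ j ∈ Iio i, q j) • g a n (Function.update x i (S.d (x i))) := by
    intro a
    have h : famPar S (g a) = sgn k (p a + 1) • g a := hg a
    rw [h, map_smul]
    change sgn k (p a + 1) • (famPre S (g a) n x) = _
    congr 1
    change (∑ i : Fin n, _ : MultilinearMap k (fun _ : Fin n => W) W) x = _
    rw [_root_.sum_apply]
    refine sum_congr rfl fun i _ => ?_
    -- On homogeneous arguments the parity involutions in front of slot `i` are scalars, whose
    -- product is the Koszul sign.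
    have h' : (fun j => (if j < i then S.par else if j = i then S.d else LinearMap.id) (x j)) =
        fun j => (if j < i then sgn k (q j) else 1) • Function.update x i (S.d (x i)) j := by
      funext j
      rcases lt_trichotomy j i with hj | rfl | hj
      · simp only [hj, if_true, Function.update_of_ne hj.ne]
        exact hx j
      · simp
      · simp [hj.not_gt, hj.ne']
    rw [MultilinearMap.compLinearMap_apply, h', MultilinearMap.map_smul_univ, prod_ite, prod_const_one,
      mul_one, sgn_sum]
    congr 2
    ext; simp
  have hd : ∀ a, (famDG S).d (g a) n x = S.d (g a n x) - famPre S (famPar S (g a)) n x :=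
    fun a => rfl
  have hde : ∀ a, C.par (C.d (e a)) = sgn k (p a + 1) • C.d (e a) := fun a => by
    rw [C.par_d, he a, map_smul, sgn_add, sgn_one, mul_neg_one, neg_smul]
  rw [diffOdd, tensorEval_sum_tmul]
  simp only [tensorEval_sum_tmul, smul_sum, map_sum]
  rw [sum_comm, ← sum_add_distrib, tensorEval_apply, map_sum, ← sum_neg_distrib]
  refine sum_congr rfl fun a _ => ?_
  have hR : (evalAt n x).lTensor B (C.par.rTensor _ ((C.tensor (famDG S).shift).d
      (e a ⊗ₜ[k] g a))) = C.par (C.d (e a)) ⊗ₜ[k] g a n x +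
        C.par (C.par (e a)) ⊗ₜ[k] (-(famDG S).d (g a) n x) := by
    rw [tensor_d_tmul, map_add, map_add]
    rfl
  have hsum : ∑ i, sgn k (∑ j ∈ Iio i, q j) • (sgn k (p a) • e a) ⊗ₜ[k]
      g a n (Function.update x i (S.d (x i))) = sgn k (p a) • e a ⊗ₜ[k]
        ∑ i, sgn k (∑ j ∈ Iio i, q j) • g a n (Function.update x i (S.d (x i))) := by
    rw [TensorProduct.tmul_sum, smul_sum]
    refine sum_congr rfl fun i _ => ?_
    rw [TensorProduct.tmul_smul, ← TensorProduct.smul_tmul', smul_comm]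
  rw [hR, hd, hpre, hde, C.par_par, hsum, tensor_d_tmul, map_smul, map_smul, he a, sgn_smul_sgn_smul,
    sgn_add, sgn_one, mul_neg_one]
  simp only [← TensorProduct.smul_tmul', TensorProduct.tmul_neg, TensorProduct.tmul_sub,
    TensorProduct.tmul_smul]
  module

end Identities

/-! ### The Maurer–Cartan equation over a finite-dimensional algebra -/

section LevelMC

variable {k : Type*} [Field k] {B : Type*} [Ring B] [Algebra k B]
  {W : Type*} [AddCommGroup W] [Module k W] {C : DGSpace k B} {S : DGSpace k W}

/-- The operations of an element of `B ⊗ (Π𝔥 ⊕ ΠV)`, with the sign of the exchange of `Π` with the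
coefficients. -/
noncomputable def levelOps (C : DGSpace k B) (ζ : B ⊗[k] (Fam k W × W)) (n : ℕ) :
    MultilinearMap k (fun _ : Fin n => W) (B ⊗[k] W) :=
  tensorEval n (C.par.rTensor _ ((LinearMap.fst k (Fam k W) W).lTensor B ζ))

theorem rTensor_par_rTensor_par {E : Type*} [AddCommGroup E] [Module k E] (t : B ⊗[k] E) :
    C.par.rTensor E (C.par.rTensor E t) = t := by
  rw [← LinearMap.comp_apply, ← LinearMap.rTensor_comp]
  have : C.par ∘ₗ C.par = LinearMap.id := LinearMap.ext C.par_par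
  rw [this, LinearMap.rTensor_id, LinearMap.id_apply]

variable [CharZero k]

/-- Evenness in `B ⊗ Π𝔥` says that `par ⊗ famPar` acts by `-1`, the sign coming from `Π`. Evaluated
on arguments this is oddness of the operations; the converse uses that `t` is determined by its
operations. -/
theorem isOdd_tensorEval_iff [Module.Finite k B] (t : B ⊗[k] Fam k W) :
    IsOdd C S (fun n => tensorEval n (C.par.rTensor _ t)) ↔
      (C.tensor (famDG S).shift).par t = t := by
  have h1 : ∀ t : B ⊗[k] Fam k W, (C.tensor (famDG S).shift).par t =
      -C.par.rTensor _ ((famPar S).lTensor B t) := by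
    intro t
    induction t using TensorProduct.induction_on with
    | zero => simp
    | tmul b g =>
      change C.par b ⊗ₜ[k] (-famPar S g) = _
      rw [TensorProduct.tmul_neg]
      rfl
    | add x y hx hy => rw [map_add, hx, hy, map_add, map_add, neg_add]
  have h3 : ∀ (t : B ⊗[k] Fam k W) n x, (C.tensor S).par (tensorEval n (C.par.rTensor _ t) x) =
      tensorEval n ((famPar S).lTensor B t) fun i => S.par (x i) := by
    intro t n x
    induction t using TensorProduct.induction_on with
    | zero => simp [tensorEval_apply]
    | tmul b g =>
      change C.par (C.par b) ⊗ₜ[k] S.par (g n x) = b ⊗ₜ[k] S.par (g n fun i => S.par (S.par (x i)))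
      simp only [C.par_par, S.par_par]
    | add y z hy hz =>
      simp only [tensorEval_apply, map_add] at hy hz ⊢
      rw [hy, hz]
  constructor
  · intro h
    rw [h1, neg_eq_iff_eq_neg, ← rTensor_par_rTensor_par (C := C) (-t)]
    congr 1
    refine tensorEval_ext fun n => ?_
    ext x
    have e := h n fun i => S.par (x i)
    simp only [h3, S.par_par] at e
    rw [e]
    simp only [tensorEval_apply, map_neg]
  · intro h n x
    dsimp only
    rw [h3]
    rw [h1, neg_eq_iff_eq_neg] at h
    have e : (famPar S).lTensor B t = -C.par.rTensor _ t := by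
      rw [← map_neg, ← h, rTensor_par_rTensor_par]
    rw [e]
    simp only [tensorEval_apply, map_neg]

theorem par_extDG_eq_iff [Module.Finite k B] (ζ : B ⊗[k] (Fam k W × W)) :
    (C.tensor (extDG S)).par ζ = ζ ↔ IsOdd C S (levelOps C ζ) ∧
      (C.tensor S).par ((LinearMap.snd k (Fam k W) W).lTensor B ζ) =
        (LinearMap.snd k (Fam k W) W).lTensor B ζ := by
  have h1 : ∀ ζ : B ⊗[k] (Fam k W × W), (LinearMap.fst k (Fam k W) W).lTensor B
      ((C.tensor (extDG S)).par ζ) = (C.tensor (famDG S).shift).par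
        ((LinearMap.fst k (Fam k W) W).lTensor B ζ) := fun ζ => by
    induction ζ using TensorProduct.induction_on with
    | zero => simp
    | tmul b z => rfl
    | add x y hx hy => simp only [map_add, hx, hy]
  have h2 : ∀ ζ : B ⊗[k] (Fam k W × W), (LinearMap.snd k (Fam k W) W).lTensor B
      ((C.tensor (extDG S)).par ζ) = (C.tensor S).par
        ((LinearMap.snd k (Fam k W) W).lTensor B ζ) := fun ζ => by
    induction ζ using TensorProduct.induction_on with
    | zero => simp
    | tmul b z => rfl
    | add x y hx hy => simp only [map_add, hx, hy]
  have h3 : IsOdd C S (levelOps C ζ) ↔ (C.tensor (famDG S).shift).par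
      ((LinearMap.fst k (Fam k W) W).lTensor B ζ) = (LinearMap.fst k (Fam k W) W).lTensor B ζ :=
    isOdd_tensorEval_iff _
  rw [h3, ← h1, ← h2]
  exact ⟨fun h => by rw [h]; exact ⟨rfl, rfl⟩, fun h => tensor_prod_ext h.1 h.2⟩

theorem sum_Icc_one_eq_sum_range {M : Type*} [AddCommMonoid M] (F : ℕ → M) (N : ℕ) :
    ∑ n ∈ Icc 1 N, F n = ∑ n ∈ range N, F (n + 1) := by
  induction N with
  | zero => simp
  | succ N ih => rw [sum_Icc_succ_top (by omega), sum_range_succ, ih]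

theorem lieCoeff_succ_mul (n : ℕ) : lieCoeff k (n + 1) * ((n + 1 : ℕ) : k) = lieCoeff k n := by
  have h1 : ((n + 1 : ℕ) : k) ≠ 0 := Nat.cast_ne_zero.mpr n.succ_ne_zero
  have h2 : (n.factorial : k) ≠ 0 := Nat.cast_ne_zero.mpr n.factorial_ne_zero
  rw [lieCoeff, lieCoeff, Nat.factorial_succ, Nat.cast_mul, mul_inv_rev, mul_assoc,
    inv_mul_cancel₀ h1, mul_one]

theorem eventually_atTop_add_iff (Q : ℕ → Prop) (l : ℕ) :
    (∀ᶠ N in atTop, Q (N + l)) ↔ ∀ᶠ N in atTop, Q N := by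
  conv_rhs => rw [← map_add_atTop_eq_nat l]
  rw [eventually_map]

/-- The Maurer–Cartan equation in `𝔥 ⊕ V` over `B`, for a composition of families and an action on
`V`, says that the operations satisfy the structure identities given by the composition and that the
component in `V` satisfies the Maurer–Cartan equation with coefficients `c`. -/
theorem isMC_extOps_iff [Module.Finite k B]
    (hmul : ∀ a b, C.par (a * b) = C.par a * C.par b)
    (hcomm : ∀ p q a b, C.IsHom p a → C.IsHom q b → a * b = sgn k (p * q) • (b * a))
    (comp : Fam k W →ₗ[k] Fam k W →ₗ[k] Fam k W) (ρ : Fam k W →ₗ[k] Fam k W)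
    (quad : (∀ n, MultilinearMap k (fun _ : Fin n => W) (B ⊗[k] W)) →
      ∀ n, (Fin n → W) → (Fin n → ZMod 2) → B ⊗[k] W)
    (hquad : ∀ (m : ℕ) (p : Fin m → ZMod 2) (e : Fin m → B) (g : Fin m → Fam k W),
      (∀ a, C.IsHom (p a) (e a)) → (∀ a, (famDG S).IsHom (p a + 1) (g a)) →
      ∀ (n : ℕ) (x : Fin n → W) (q : Fin n → ZMod 2), (∀ i, S.IsHom (q i) (x i)) →
        quad (fun n => tensorEval n (∑ a, (sgn k (p a) • e a) ⊗ₜ[k] g a)) n x q =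
          tensorEval n (tensorComp comp p e g) x)
    (c : ℕ → k)
    (hρ : ∀ (n : ℕ) (t : B ⊗[k] Fam k W) (ξ : B ⊗[k] W), (C.tensor S).par ξ = ξ →
      lieCoeff k n • oddExt C S (tensorEval n (ρ.lTensor B t)) (fun _ => ξ) =
        c n • oddExt C S (tensorEval n t) fun _ => ξ)
    (ζ : B ⊗[k] (Fam k W × W)) (h0 : levelOps C ζ 0 = 0) :
    IsMC C (extDG S) (lieCoeff k) (fun n => (TensorProduct.mk k B (Fam k W × W) 1).compMultilinearMap
        (extOps S (bracket S comp) ρ n)) ζ ↔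
      (IsOdd C S (levelOps C ζ) ∧ ∀ (n : ℕ) (x : Fin n → W) (q : Fin n → ZMod 2),
        (∀ i, S.IsHom (q i) (x i)) →
          diffOdd C S (levelOps C ζ n) x q + quad (levelOps C ζ) n x q = 0) ∧
      IsMC C S c (levelOps C ζ) ((LinearMap.snd k (Fam k W) W).lTensor B ζ) := by
  have heven := par_extDG_eq_iff (C := C) (S := S) ζ
  -- Both sides contain evenness of `ζ`, on the right in the form of odd operations and an even `ξ`.
  -- Homogeneous decompositions are available only in the even case.
  by_cases hζ : (C.tensor (extDG S)).par ζ = ζ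
  swap
  · constructor
    · exact fun h => absurd h.1 hζ
    · exact fun h => absurd (heven.mpr ⟨h.1.1, h.2.1⟩) hζ
  obtain ⟨hodd, hξ⟩ := heven.mp hζ
  rw [IsMC, IsMC, and_iff_right hζ, and_iff_right hodd, and_iff_right hξ]
  obtain ⟨m, p, e, z, he, hz, rfl⟩ := exists_sum_tmul_isHom C (extDG S) ζ hζ
  obtain ⟨g, w, rfl⟩ : ∃ (g : Fin m → Fam k W) (w : Fin m → W), z = fun a => (g a, w a) :=
    ⟨fun a => (z a).1, fun a => (z a).2, rfl⟩
  have hg : ∀ a, (famDG S).IsHom (p a + 1) (g a) := fun a => (extDG_isHom_iff.mp (hz a)).1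
  have hfst : (LinearMap.fst k (Fam k W) W).lTensor B (∑ a, e a ⊗ₜ[k] (g a, w a)) =
      ∑ a, e a ⊗ₜ[k] g a := by simp
  have hsnd : (LinearMap.snd k (Fam k W) W).lTensor B (∑ a, e a ⊗ₜ[k] (g a, w a)) =
      ∑ a, e a ⊗ₜ[k] w a := by simp
  have hops : levelOps C (∑ a, e a ⊗ₜ[k] (g a, w a)) =
      fun n => tensorEval n (∑ a, (sgn k (p a) • e a) ⊗ₜ[k] g a) := by
    funext n
    rw [levelOps, hfst, map_sum]
    congr 1
    exact sum_congr rfl fun a _ => by rw [LinearMap.rTensor_tmul, he a]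
  rw [hsnd] at hξ ⊢
  rw [hops] at h0 ⊢
  set ξ := ∑ a, e a ⊗ₜ[k] w a with hξdef
  set T := ∑ a, (sgn k (p a) • e a) ⊗ₜ[k] g a with hT
  -- The component of the Maurer–Cartan equation in `Π𝔥`; up to the invertible `-C.par` its
  -- operations are the left-hand sides of the structure identities.
  set X := (C.tensor (famDG S).shift).d (∑ a, e a ⊗ₜ[k] g a) -
    C.par.rTensor _ (tensorComp comp p e g) with hX
  have hquadX : (∀ (n : ℕ) (x : Fin n → W) (q : Fin n → ZMod 2), (∀ i, S.IsHom (q i) (x i)) →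
      diffOdd C S (tensorEval n T) x q + quad (fun n => tensorEval n T) n x q = 0) ↔ X = 0 := by
    have h1 : ∀ (n : ℕ) (x : Fin n → W) (q : Fin n → ZMod 2), (∀ i, S.IsHom (q i) (x i)) →
        diffOdd C S (tensorEval n T) x q + quad (fun n => tensorEval n T) n x q =
          -tensorEval n (C.par.rTensor _ X) x := by
      intro n x q hx
      rw [diffOdd_tensorEval he hg hx, hquad m p e g he hg n x q hx, hX, map_sub,
        rTensor_par_rTensor_par, tensorEval_apply, tensorEval_apply, tensorEval_apply, map_sub]
      abel
    constructor
    · intro h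
      rw [← rTensor_par_rTensor_par (C := C) X]
      have : C.par.rTensor _ X = 0 := by
        refine tensorEval_ext fun n => multilinear_ext_isHom S fun x q hx => ?_
        rw [← neg_inj, ← h1 n x q hx, h n x q hx, tensorEval_apply, map_zero, neg_zero]
      rw [this, map_zero]
    · intro h n x q hx
      rw [h1 n x q hx, h, map_zero, tensorEval_apply, map_zero, neg_zero]
  have hρT : ∑ a, (sgn k (p a) • e a) ⊗ₜ[k] ρ (g a) = ρ.lTensor B T := by
    simp [hT]
  have hd : (C.tensor (extDG S)).d (∑ a, e a ⊗ₜ[k] (g a, w a)) =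
      (LinearMap.inl k (Fam k W) W).lTensor B
        ((C.tensor (famDG S).shift).d (∑ a, e a ⊗ₜ[k] g a)) +
      (LinearMap.inr k (Fam k W) W).lTensor B ((C.tensor S).d ξ) := by
    simp only [hξdef, map_sum, ← sum_add_distrib, tensor_d_tmul, map_add, LinearMap.lTensor_tmul]
    refine sum_congr rfl fun a _ => ?_
    rw [add_add_add_comm, ← TensorProduct.tmul_add, ← TensorProduct.tmul_add]
    simp only [LinearMap.inl_apply, LinearMap.inr_apply, Prod.mk_add_mk, add_zero, zero_add]
    rfl
  -- The bracket contributes only in arity `2`, i.e. for `n = 1`; the bound `N + 2` ensures that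
  -- this term is present.
  have hbr : ∀ N, ∑ n ∈ range (N + 2), lieCoeff k (n + 1) • oddExt C (extDG S)
      ((TensorProduct.mk k B (Fam k W × W) 1).compMultilinearMap
        (bracketOp S (bracket S comp) (n + 1))) (fun _ => ∑ a, e a ⊗ₜ[k] (g a, w a)) =
      -(LinearMap.inl k (Fam k W) W).lTensor B (C.par.rTensor _ (tensorComp comp p e g)) := by
    intro N
    rw [sum_eq_single 1]
    · rw [oddExt_bracketOp hmul hcomm comp he hz, smul_neg, smul_smul]
      have : lieCoeff k (1 + 1) * 2 = 1 := by simp [lieCoeff]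
      rw [this, one_smul]
    · intro n _ hn
      have : bracketOp S (bracket S comp) (n + 1) = 0 := by
        rcases n with _ | _ | n
        · rfl
        · exact absurd rfl hn
        · rfl
      rw [this]
      have h' : (TensorProduct.mk k B (Fam k W × W) 1).compMultilinearMap
        (0 : MultilinearMap k (fun _ : Fin (n + 1) => Fam k W × W) (Fam k W × W)) = 0 := by
        ext; simp
      rw [h', oddExt_zero]
      simp
    · intro h
      exact absurd (mem_range.mpr (by omega)) h
  have hact : ∀ N, ∑ n ∈ range (N + 2), lieCoeff k (n + 1) • oddExt C (extDG S)
      ((TensorProduct.mk k B (Fam k W × W) 1).compMultilinearMap (actionOp S ρ (n + 1)))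
        (fun _ => ∑ a, e a ⊗ₜ[k] (g a, w a)) =
      (LinearMap.inr k (Fam k W) W).lTensor B
        (∑ n ∈ Icc 1 (N + 1), c n • oddExt C S (tensorEval n T) fun _ => ξ) := by
    intro N
    have h1 : ∀ n, lieCoeff k (n + 1) • oddExt C (extDG S)
        ((TensorProduct.mk k B (Fam k W × W) 1).compMultilinearMap (actionOp S ρ (n + 1)))
          (fun _ => ∑ a, e a ⊗ₜ[k] (g a, w a)) =
        (LinearMap.inr k (Fam k W) W).lTensor B
          (c n • oddExt C S (tensorEval n T) fun _ => ξ) := fun n => by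
      rw [oddExt_actionOp hmul hcomm ρ he hz n, hρT, smul_smul, lieCoeff_succ_mul, ← map_smul,
        hρ n T ξ hξ]
    simp only [h1, ← map_sum]
    -- Arity `1` of the action corresponds to an operation without arguments, absent from the series
    -- for `ξ`; it vanishes by `h0`.
    rw [sum_Icc_one_eq_sum_range, sum_range_succ' _ (N + 1)]
    have h2 : tensorEval 0 T = 0 := h0
    rw [h2, oddExt_zero]
    simp
  have hP : ∀ N, (C.tensor (extDG S)).d (∑ a, e a ⊗ₜ[k] (g a, w a)) +
      ∑ n ∈ Icc 1 (N + 2), lieCoeff k n • oddExt C (extDG S)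
        ((TensorProduct.mk k B (Fam k W × W) 1).compMultilinearMap
          (extOps S (bracket S comp) ρ n)) (fun _ => ∑ a, e a ⊗ₜ[k] (g a, w a)) =
      (LinearMap.inl k (Fam k W) W).lTensor B X + (LinearMap.inr k (Fam k W) W).lTensor B
        ((C.tensor S).d ξ + ∑ n ∈ Icc 1 (N + 1), c n • oddExt C S (tensorEval n T) fun _ => ξ) := by
    intro N
    have h1 : ∀ n, (TensorProduct.mk k B (Fam k W × W) 1).compMultilinearMap
          (extOps S (bracket S comp) ρ n) =
        (TensorProduct.mk k B (Fam k W × W) 1).compMultilinearMap (bracketOp S (bracket S comp) n) +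
        (TensorProduct.mk k B (Fam k W × W) 1).compMultilinearMap (actionOp S ρ n) := fun n => by
      ext x
      simp [extOps]
    rw [sum_Icc_one_eq_sum_range]
    simp only [h1, oddExt_add, add_apply, smul_add, sum_add_distrib]
    rw [hbr, hact, hd, hX, map_sub, map_add]
    abel
  have hsplit : ∀ (s : B ⊗[k] Fam k W) (t : B ⊗[k] W), (LinearMap.inl k (Fam k W) W).lTensor B s +
      (LinearMap.inr k (Fam k W) W).lTensor B t = 0 ↔ s = 0 ∧ t = 0 := by
    intro s t
    constructor
    · intro h
      have h1 := congrArg ((LinearMap.fst k (Fam k W) W).lTensor B) h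
      have h2 := congrArg ((LinearMap.snd k (Fam k W) W).lTensor B) h
      rw [lTensor_fst_inl_add_inr, map_zero] at h1
      rw [lTensor_snd_inl_add_inr, map_zero] at h2
      exact ⟨h1, h2⟩
    · rintro ⟨rfl, rfl⟩
      simp
  -- The vector field occupies one argument, so the partial sum up to `N + 2` in `𝔥 ⊕ V` matches the
  -- one up to `N + 1` in `V`. Eventual vanishing is insensitive to both shifts.
  rw [← eventually_atTop_add_iff _ 2, hquadX, ← eventually_atTop_add_iff (fun N => _ + ∑ n ∈ Icc 1 N, _ = 0) 1]
  simp only [hP, hsplit]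
  rw [eventually_and, eventually_const]

end LevelMC

/-! ### Conditions on the coefficients -/

section Conditions

variable {k : Type*} [Field k] {B : Type*} [Ring B] [Algebra k B]
  {W : Type*} [AddCommGroup W] [Module k W] {C : DGSpace k B} {S : DGSpace k W}

/-- A linear condition can be tested coefficientwise, and the sign `C.par` acts invertibly on the
coefficients. This carries each condition defining `𝔥` over to the operations. -/
theorem forall_tensorCoord_eq_zero_iff {ι F : Type*} [Fintype ι] [AddCommGroup F] [Module k F]
    (b : Module.Basis ι k B) (L : Fam k W →ₗ[k] F) (t : B ⊗[k] Fam k W) :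
    (∀ j, L (tensorCoord b _ j t) = 0) ↔ L.lTensor B (C.par.rTensor _ t) = 0 := by
  rw [← lTensor_eq_zero_iff, ← rTensor_lTensor_comm]
  constructor
  · intro h
    rw [h, map_zero]
  · intro h
    rw [← rTensor_par_rTensor_par (C := C) (L.lTensor B t), h, map_zero]

theorem mem_range_prod_top_iff {ι : Type*} [Fintype ι] (b : Module.Basis ι k B)
    (K : Submodule k (Fam k W)) (ζ : B ⊗[k] (Fam k W × W)) :
    ζ ∈ LinearMap.range ((K.prod (⊤ : Submodule k W)).subtype.lTensor B) ↔
      ∀ j, tensorCoord b _ j ((LinearMap.fst k (Fam k W) W).lTensor B ζ) ∈ K := by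
  rw [mem_range_lTensor_subtype_iff b]
  simp only [tensorCoord_lTensor, Submodule.mem_prod, Submodule.mem_top, and_true,
    LinearMap.fst_apply]

theorem levelOps_apply (ζ : B ⊗[k] (Fam k W × W)) (n : ℕ) (x : Fin n → W) :
    levelOps C ζ n x = (evalAt n x).lTensor B
      (C.par.rTensor _ ((LinearMap.fst k (Fam k W) W).lTensor B ζ)) := rfl

theorem forall_mem_assFields_iff {ι : Type*} [Fintype ι] (b : Module.Basis ι k B)
    (ζ : B ⊗[k] (Fam k W × W)) :
    (∀ j, tensorCoord b _ j ((LinearMap.fst k (Fam k W) W).lTensor B ζ) ∈ assFields k W) ↔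
      levelOps C ζ 0 = 0 := by
  constructor
  · intro h
    ext x
    rw [levelOps_apply]
    exact (forall_tensorCoord_eq_zero_iff b (evalAt 0 x) _).mp fun j =>
      congrArg (fun f => f x) (h j)
  · intro h j
    change tensorCoord b (Fam k W) j _ 0 = 0
    ext x
    exact (forall_tensorCoord_eq_zero_iff (C := C) b (evalAt 0 x) _).mpr
      (congrArg (fun f => f x) h) j

theorem lTensor_sub_smul {E F : Type*} [AddCommGroup E] [Module k E] [AddCommGroup F] [Module k F]
    (L L' : E →ₗ[k] F) (c : k) (t : B ⊗[k] E) :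
    (L - c • L').lTensor B t = L.lTensor B t - c • L'.lTensor B t := by
  rw [LinearMap.lTensor_sub, LinearMap.lTensor_smul]
  rfl

theorem forall_isSymm_iff {ι : Type*} [Fintype ι] (b : Module.Basis ι k B)
    (ζ : B ⊗[k] (Fam k W × W)) :
    (∀ j n, IsSymm S (tensorCoord b _ j ((LinearMap.fst k (Fam k W) W).lTensor B ζ) n)) ↔
      ∀ n, IsSymm S (levelOps C ζ n) := by
  -- Symmetry at fixed arguments is the vanishing of a difference of evaluation maps, hence a linear
  -- condition.
  have key : ∀ n (i j : Fin n) (x : Fin n → W) (c : k),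
      (∀ l, tensorCoord b _ l ((LinearMap.fst k (Fam k W) W).lTensor B ζ) n (x ∘ Equiv.swap i j) =
        c • tensorCoord b _ l ((LinearMap.fst k (Fam k W) W).lTensor B ζ) n x) ↔
      levelOps C ζ n (x ∘ Equiv.swap i j) = c • levelOps C ζ n x := by
    intro n i j x c
    have := forall_tensorCoord_eq_zero_iff (C := C) b
      (evalAt n (x ∘ Equiv.swap i j) - c • evalAt n x) ((LinearMap.fst k (Fam k W) W).lTensor B ζ)
    rw [lTensor_sub_smul, sub_eq_zero] at this
    simp only [LinearMap.sub_apply, LinearMap.smul_apply, sub_eq_zero] at this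
    exact this
  exact ⟨fun h n i j hij x p hx => (key n i j x _).mp fun l => h l n i j hij x p hx,
    fun h l n i j hij x p hx => (key n i j x _).mpr (h n i j hij x p hx) l⟩

/-- At fixed arguments cyclicity is a linear equation in the family with values in `k`; with
coefficients its values lie in `B ⊗ k`, identified with `B` by `rid`. -/
theorem forall_mem_sympFields_iff {ι : Type*} [Fintype ι] (b : Module.Basis ι k B)
    (ω : W →ₗ[k] W →ₗ[k] k) (ζ : B ⊗[k] (Fam k W × W)) :
    (∀ j, tensorCoord b _ j ((LinearMap.fst k (Fam k W) W).lTensor B ζ) ∈ sympFields S ω) ↔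
      ∀ n, IsCyclic S (fun y => (TensorProduct.rid k B).toLinearMap ∘ₗ (ω.flip y).lTensor B)
        (levelOps C ζ n) := by
  have key : ∀ n (x y : W) (v w : Fin n → W) (c : k),
      (∀ l, ω.flip x (tensorCoord b _ l ((LinearMap.fst k (Fam k W) W).lTensor B ζ) n v) =
        c • ω.flip y (tensorCoord b _ l ((LinearMap.fst k (Fam k W) W).lTensor B ζ) n w)) ↔
      TensorProduct.rid k B ((ω.flip x).lTensor B (levelOps C ζ n v)) =
        c • TensorProduct.rid k B ((ω.flip y).lTensor B (levelOps C ζ n w)) := by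
    intro n x y v w c
    have := forall_tensorCoord_eq_zero_iff (C := C) b
      (ω.flip x ∘ₗ evalAt n v - c • (ω.flip y ∘ₗ evalAt n w))
      ((LinearMap.fst k (Fam k W) W).lTensor B ζ)
    rw [lTensor_sub_smul, sub_eq_zero] at this
    simp only [LinearMap.sub_apply, LinearMap.smul_apply, sub_eq_zero, LinearMap.lTensor_comp,
      LinearMap.comp_apply] at this
    rw [← map_smul, (TensorProduct.rid k B).injective.eq_iff]
    exact this
  exact ⟨fun h n x p hx => (key n _ _ _ _ _).mp fun l => h l n x p hx,
    fun h l n x p hx => (key n _ _ _ _ _).mpr (h n x p hx) l⟩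

theorem forall_mem_lieFields_iff {ι : Type*} [Fintype ι] (b : Module.Basis ι k B)
    (ζ : B ⊗[k] (Fam k W × W)) :
    (∀ j, tensorCoord b _ j ((LinearMap.fst k (Fam k W) W).lTensor B ζ) ∈ lieFields S) ↔
      levelOps C ζ 0 = 0 ∧ ∀ n, IsSymm S (levelOps C ζ n) := by
  rw [← forall_mem_assFields_iff b, ← forall_isSymm_iff b, ← forall_and]
  rfl

end Conditions

/-! ### The identification of elements with pairs -/

section Split

variable {k : Type*} [Field k] {W : Type*} [AddCommGroup W] [Module k W] (A : FormalCDGA k)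

instance (i : A.Idx) : Module.Finite k (A.Alg i) := (A.cdga i).finite

theorem tensor_ext {E : Type*} [AddCommGroup E] [Module k E] {ξ η : A.tensor E}
    (h : ∀ i, A.at E i ξ = A.at E i η) : ξ = η :=
  Subtype.ext (funext h)

theorem ops_ext {n : ℕ} {f g : MultilinearMap k (fun _ : Fin n => W) (A.tensor W)}
    (h : ∀ i, (A.at W i).compMultilinearMap f = (A.at W i).compMultilinearMap g) : f = g := by
  ext1 x
  exact tensor_ext A fun i => congrArg (fun F => F x) (h i)

theorem split_fst_at (ξ : A.tensor (Fam k W × W)) (i : A.Idx) :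
    (split A ξ).1.at i = levelOps (A.cdga i).toDGSpace (A.at _ i ξ) := by
  funext n
  ext x
  change (A.cdga i).par.rTensor W ((evalAt n x ∘ₗ LinearMap.fst k (Fam k W) W).lTensor (A.Alg i)
    (A.at _ i ξ)) = _
  rw [levelOps, tensorEval_rTensor, tensorEval_apply, LinearMap.lTensor_comp]
  rfl

theorem split_snd_at (ξ : A.tensor (Fam k W × W)) (i : A.Idx) :
    A.at W i (split A ξ).2 = (LinearMap.snd k (Fam k W) W).lTensor (A.Alg i) (A.at _ i ξ) := rfl

theorem split_injective : Function.Injective (split (W := W) A) := by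
  intro ξ η h
  refine tensor_ext A fun i => ?_
  refine tensor_prod_ext ?_ ?_
  · rw [← rTensor_par_rTensor_par (C := (A.cdga i).toDGSpace)
      ((LinearMap.fst k (Fam k W) W).lTensor (A.Alg i) (A.at _ i ξ)),
      ← rTensor_par_rTensor_par (C := (A.cdga i).toDGSpace)
      ((LinearMap.fst k (Fam k W) W).lTensor (A.Alg i) (A.at _ i η))]
    congr 1
    refine tensorEval_ext fun n => ?_
    change levelOps _ _ n = levelOps _ _ n
    rw [← split_fst_at, ← split_fst_at, h]
  · rw [← split_snd_at, ← split_snd_at, h]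

/-- The operations at each level come from a unique tensor. Uniqueness forces these tensors to be
compatible and to be killed by the augmentation, so that they define an element of the limit. -/
theorem split_surjective : Function.Surjective (split (W := W) A) := by
  rintro ⟨m, x⟩
  choose t ht using fun i => exists_tensorEval_eq (M := A.Alg i) (m.at i)
  have haug : ∀ i, (A.cdga i).aug.toLinearMap.rTensor _ (t i) = 0 := fun i => by
    refine tensorEval_ext fun n => ?_
    ext1 y
    rw [tensorEval_rTensor, ht, tensorEval_apply, map_zero]
    exact (m n y).2.1 i
  have hmap : ∀ i j (h : i ≤ j), (A.map h).toLinearMap.rTensor _ (t j) = t i := fun i j h => by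
    refine tensorEval_ext fun n => ?_
    ext1 y
    rw [tensorEval_rTensor, ht, ht]
    exact (m n y).2.2 i j h
  have hpar : ∀ i, (A.cdga i).aug.toLinearMap ∘ₗ (A.cdga i).par = (A.cdga i).aug.toLinearMap :=
    fun i => LinearMap.ext (A.cdga i).aug_par
  have hpar' : ∀ i j (h : i ≤ j), (A.map h).toLinearMap ∘ₗ (A.cdga j).par =
      (A.cdga i).par ∘ₗ (A.map h).toLinearMap := fun i j h => LinearMap.ext (A.map_par h)
  have hx : ∀ i, (A.cdga i).aug.toLinearMap.rTensor _ (A.at W i x) = 0 := x.2.1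
  have hx' : ∀ i j (h : i ≤ j), (A.map h).toLinearMap.rTensor _ (A.at W j x) = A.at W i x := x.2.2
  -- The sign built into `split` is an involution on the coefficients, so it is inverted by applying
  -- it once more.
  refine ⟨⟨fun i => (LinearMap.inl k (Fam k W) W).lTensor _ ((A.cdga i).par.rTensor _ (t i)) +
    (LinearMap.inr k (Fam k W) W).lTensor _ (A.at W i x), fun i => ?_, fun i j h => ?_⟩, ?_⟩
  · rw [map_add, rTensor_lTensor_comm, rTensor_lTensor_comm, hx,
      ← LinearMap.rTensor_comp_apply, hpar, haug, map_zero, map_zero, add_zero]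
  · rw [map_add, rTensor_lTensor_comm, rTensor_lTensor_comm, hx',
      ← LinearMap.rTensor_comp_apply, hpar', LinearMap.rTensor_comp_apply, hmap]
  · refine Prod.ext (funext fun n => ops_ext A fun i => ?_) (tensor_ext A fun i =>
      lTensor_snd_inl_add_inr _ _)
    refine (congrFun (split_fst_at A _ i) n).trans ?_
    refine Eq.trans ?_ (ht i n)
    rw [levelOps]
    refine (congrArg (fun s => tensorEval n ((A.cdga i).par.rTensor _ s))
      (lTensor_fst_inl_add_inr _ _)).trans ?_
    exact congrArg (tensorEval n) (rTensor_par_rTensor_par _)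

theorem bijOn_split {X : Set (A.tensor (Fam k W × W))}
    {Y : Set (Ops A W × A.tensor W)} (h : ∀ ξ, ξ ∈ X ↔ split A ξ ∈ Y) :
    Set.BijOn (split A) X Y := by
  refine ⟨fun ξ hξ => (h ξ).mp hξ, (split_injective A).injOn, fun y hy => ?_⟩
  obtain ⟨ξ, rfl⟩ := split_surjective A y
  exact ⟨ξ, (h ξ).mpr hy, rfl⟩

theorem ops_zero_eq_zero_iff (m : Ops A W) : m 0 = 0 ↔ ∀ i, m.at i 0 = 0 := by
  constructor
  · intro h i
    rw [Ops.at, h]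
    ext x
    simp
  · intro h
    refine ops_ext A fun i => (h i).trans ?_
    ext x
    simp

theorem isSymm_iff_forall_at (S : DGSpace k W) (m : Ops A W) :
    (∀ n, IsSymm S (m n)) ↔ ∀ i n, IsSymm S (m.at i n) := by
  constructor
  · intro h i n a b hab x p hx
    exact (congrArg (A.at W i) (h n a b hab x p hx)).trans (map_smul _ _ _)
  · intro h n a b hab x p hx
    exact tensor_ext A fun i => (h i n a b hab x p hx).trans (map_smul (A.at W i) _ _).symm

variable [CharZero k]

/-- The Maurer–Cartan elements in `𝔥 ⊕ V`, for `𝔥` given by the condition `P` on operations. -/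
theorem mem_bigMC_iff (S : DGSpace k W)
    (K : Submodule k (Fam k W))
    (P : ∀ i, (∀ n, MultilinearMap k (fun _ : Fin n => W) (A.Alg i ⊗[k] W)) → Prop)
    (hP : ∀ i (ζ : A.Alg i ⊗[k] (Fam k W × W)),
      (∀ j, tensorCoord (Module.finBasis k (A.Alg i)) _ j
        ((LinearMap.fst k (Fam k W) W).lTensor _ ζ) ∈ K) ↔
      levelOps (A.cdga i).toDGSpace ζ 0 = 0 ∧ P i (levelOps (A.cdga i).toDGSpace ζ))
    (comp : Fam k W →ₗ[k] Fam k W →ₗ[k] Fam k W) (ρ : Fam k W →ₗ[k] Fam k W)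
    (quad : ∀ i, (∀ n, MultilinearMap k (fun _ : Fin n => W) (A.Alg i ⊗[k] W)) →
      ∀ n, (Fin n → W) → (Fin n → ZMod 2) → A.Alg i ⊗[k] W)
    (hquad : ∀ i (m : ℕ) (p : Fin m → ZMod 2) (e : Fin m → A.Alg i) (g : Fin m → Fam k W),
      (∀ a, (A.cdga i).IsHom (p a) (e a)) → (∀ a, (famDG S).IsHom (p a + 1) (g a)) →
      ∀ (n : ℕ) (x : Fin n → W) (q : Fin n → ZMod 2), (∀ i, S.IsHom (q i) (x i)) →
        quad i (fun n => tensorEval n (∑ a, (sgn k (p a) • e a) ⊗ₜ[k] g a)) n x q =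
          tensorEval n (tensorComp comp p e g) x)
    (c : ℕ → k)
    (hρ : ∀ i (n : ℕ) (t : A.Alg i ⊗[k] Fam k W) (ξ : A.Alg i ⊗[k] W),
      ((A.cdga i).tensor S).par ξ = ξ →
      lieCoeff k n • oddExt (A.cdga i).toDGSpace S (tensorEval n (ρ.lTensor _ t)) (fun _ => ξ) =
        c n • oddExt (A.cdga i).toDGSpace S (tensorEval n t) fun _ => ξ)
    (ξ : A.tensor (Fam k W × W)) :
    ξ ∈ bigMC A (extDG S) (K.prod ⊤) (extOps S (bracket S comp) ρ) ↔
      (split A ξ).1 0 = 0 ∧ (∀ i, P i ((split A ξ).1.at i)) ∧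
      (∀ i, IsOdd (A.cdga i).toDGSpace S ((split A ξ).1.at i) ∧
        ∀ (n : ℕ) (x : Fin n → W) (q : Fin n → ZMod 2), (∀ i, S.IsHom (q i) (x i)) →
          diffOdd (A.cdga i).toDGSpace S ((split A ξ).1.at i n) x q +
            quad i ((split A ξ).1.at i) n x q = 0) ∧
      (split A ξ).2 ∈ MC A S c (split A ξ).1 := by
  rw [ops_zero_eq_zero_iff, bigMC, MC, Set.mem_ofPred_eq, Set.mem_ofPred_eq]
  simp only [split_fst_at, split_snd_at, ← forall_and]
  refine forall_congr' fun i => ?_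
  rw [mem_range_prod_top_iff (Module.finBasis k (A.Alg i)), hP, and_assoc]
  refine and_congr_right fun h0 => and_congr_right fun _ => ?_
  exact isMC_extOps_iff (A.cdga i).par_mul (A.cdga i).comm comp ρ (quad i) (hquad i) c (hρ i) _ h0

end Split

/-! ### The commutative and the noncommutative case -/

section Main

variable {k : Type*} [Field k] [CharZero k] {W : Type*} [AddCommGroup W] [Module k W]

theorem mem_bigMC_lie_iff (A : FormalCDGA k) (S : DGSpace k W) (K : Submodule k (Fam k W))
    (P : ∀ i, (∀ n, MultilinearMap k (fun _ : Fin n => W) (A.Alg i ⊗[k] W)) → Prop)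
    (hP : ∀ i (ζ : A.Alg i ⊗[k] (Fam k W × W)),
      (∀ j, tensorCoord (Module.finBasis k (A.Alg i)) _ j
        ((LinearMap.fst k (Fam k W) W).lTensor _ ζ) ∈ K) ↔
      levelOps (A.cdga i).toDGSpace ζ 0 = 0 ∧ P i (levelOps (A.cdga i).toDGSpace ζ))
    (ξ : A.tensor (Fam k W × W)) :
    ξ ∈ bigMC A (extDG S) (K.prod ⊤) (extOps S (bracket S (lieComp S)) LinearMap.id) ↔
      (split A ξ).1 0 = 0 ∧ (∀ i, P i ((split A ξ).1.at i)) ∧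
      (∀ i, IsOdd (A.cdga i).toDGSpace S ((split A ξ).1.at i) ∧
        LInftyIdentities (A.cdga i).toDGSpace S ((split A ξ).1.at i)) ∧
      (split A ξ).2 ∈ MC A S (lieCoeff k) (split A ξ).1 :=
  mem_bigMC_iff A S K P hP (lieComp S) LinearMap.id
    (fun i f n x q => ∑ s : Finset (Fin n) with s.Nonempty, shuffleSgn k s q •
        oddExt (A.cdga i).toDGSpace S (f (#sᶜ + 1)) ((0 : Fin (#sᶜ + 1)).insertNth
          (f #s (x ∘ s.orderEmbOfFin rfl))
          (fun l => (1 : A.Alg i) ⊗ₜ[k] x (sᶜ.orderEmbOfFin rfl l))))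
    (fun i _ _ _ _ he hg _ _ _ hx =>
      lie_quadratic (A.cdga i).par_mul (A.cdga i).comm he hg hx)
    (lieCoeff k) (fun i n t ξ _ => by rw [LinearMap.lTensor_id, LinearMap.id_apply]) ξ

/-- The coefficients pass from `1/n!` to `1` because symmetrization multiplies the `n`-th term by
`n!`, which is invertible in characteristic zero. -/
theorem mem_bigMC_ass_iff (A : FormalCDGA k) (S : DGSpace k W) (K : Submodule k (Fam k W))
    (P : ∀ i, (∀ n, MultilinearMap k (fun _ : Fin n => W) (A.Alg i ⊗[k] W)) → Prop)
    (hP : ∀ i (ζ : A.Alg i ⊗[k] (Fam k W × W)),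
      (∀ j, tensorCoord (Module.finBasis k (A.Alg i)) _ j
        ((LinearMap.fst k (Fam k W) W).lTensor _ ζ) ∈ K) ↔
      levelOps (A.cdga i).toDGSpace ζ 0 = 0 ∧ P i (levelOps (A.cdga i).toDGSpace ζ))
    (ξ : A.tensor (Fam k W × W)) :
    ξ ∈ bigMC A (extDG S) (K.prod ⊤) (extOps S (bracket S (assComp S)) (symmetrize S)) ↔
      (split A ξ).1 0 = 0 ∧ (∀ i, P i ((split A ξ).1.at i)) ∧
      (∀ i, IsOdd (A.cdga i).toDGSpace S ((split A ξ).1.at i) ∧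
        AInftyIdentities (A.cdga i).toDGSpace S ((split A ξ).1.at i)) ∧
      (split A ξ).2 ∈ MC A S (assCoeff k) (split A ξ).1 :=
  mem_bigMC_iff A S K P hP (assComp S) (symmetrize S)
    (fun i f n x q => ∑ a : Fin n, ∑ b ∈ Ici a, sgn k (∑ i ∈ Iio a, q i) •
        oddExt (A.cdga i).toDGSpace S (f (#(Icc a b)ᶜ + 1)) ((slot a b).insertNth
          (f #(Icc a b) (x ∘ (Icc a b).orderEmbOfFin rfl))
          (fun l => (1 : A.Alg i) ⊗ₜ[k] x ((Icc a b)ᶜ.orderEmbOfFin rfl l))))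
    (fun i _ _ _ _ he hg _ _ _ hx =>
      ass_quadratic (A.cdga i).par_mul (A.cdga i).comm he hg hx)
    (assCoeff k) (fun i n t ξ hξ => by
      have h : (n.factorial : k) ≠ 0 := Nat.cast_ne_zero.mpr n.factorial_ne_zero
      rw [oddExt_symmetrize (A.cdga i).comm n t hξ, smul_smul, lieCoeff, inv_mul_cancel₀ h,
        assCoeff]) ξ

end Main

end MCFields

/-- For each of the four `L∞` algebras `𝔠̃(V)`, `𝔞̃(V)`, `𝔠̃𝔰(V)`, `𝔞̃𝔰(V)`, the identification `split` of
elements of `A₊ ⊗ Π(𝔥 ⊕ V)` with pairs of a family of operations `(ΠV)ⁿ → A₊ ⊗ ΠV` and an element of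
`A₊ ⊗ ΠV` restricts to a bijection from the Maurer–Cartan elements onto the pairs of an `A`-linear
structure on `V` of the respective type and a Maurer–Cartan element in it. -/
theorem theorem3p9 {k : Type*} [Field k] [CharZero k] {V : Type*} [AddCommGroup V] [Module k V]
    (S : MCFields.DGSpace k V) (A : MCFields.FormalCDGA k) :
    Set.BijOn (MCFields.split A) (MCFields.mcLie A S)
      {q | MCFields.IsLInfty A S.shift q.1 ∧
        q.2 ∈ MCFields.MC A S.shift (MCFields.lieCoeff k) q.1} ∧
    (∀ β : MCFields.ScalarProduct S,
      Set.BijOn (MCFields.split A) (MCFields.mcCyclicLie A S β)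
        {q | MCFields.IsLInfty A S.shift q.1 ∧ MCFields.IsCyclicOps A S.shift β.omega q.1 ∧
          q.2 ∈ MCFields.MC A S.shift (MCFields.lieCoeff k) q.1}) ∧
    Set.BijOn (MCFields.split A) (MCFields.mcAss A S)
      {q | MCFields.IsAInfty A S.shift q.1 ∧
        q.2 ∈ MCFields.MC A S.shift (MCFields.assCoeff k) q.1} ∧
    (∀ β : MCFields.ScalarProduct S,
      Set.BijOn (MCFields.split A) (MCFields.mcCyclicAss A S β)
        {q | MCFields.IsAInfty A S.shift q.1 ∧ MCFields.IsCyclicOps A S.shift β.omega q.1 ∧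
          q.2 ∈ MCFields.MC A S.shift (MCFields.assCoeff k) q.1}) := by
  refine ⟨MCFields.bijOn_split A fun ξ => ?_, fun β => MCFields.bijOn_split A fun ξ => ?_,
    MCFields.bijOn_split A fun ξ => ?_, fun β => MCFields.bijOn_split A fun ξ => ?_⟩
  · refine (MCFields.mem_bigMC_lie_iff A S.shift _ (fun i f => ∀ n, MCFields.IsSymm S.shift (f n))
      (fun i ζ => MCFields.forall_mem_lieFields_iff _ ζ) ξ).trans ?_
    simp only [Set.mem_ofPred_eq, MCFields.IsLInfty, MCFields.isSymm_iff_forall_at, and_assoc]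
  · refine (MCFields.mem_bigMC_lie_iff A S.shift _ (fun i f =>
      (∀ n, MCFields.IsSymm S.shift (f n)) ∧ ∀ n, MCFields.IsCyclic S.shift (fun y =>
        (TensorProduct.rid k (A.Alg i)).toLinearMap ∘ₗ (β.omega.flip y).lTensor (A.Alg i)) (f n))
      (fun i ζ => ?_) ξ).trans ?_
    · simp only [Submodule.mem_inf, forall_and]
      rw [MCFields.forall_mem_lieFields_iff, MCFields.forall_mem_sympFields_iff, and_assoc]
    · simp only [Set.mem_ofPred_eq, MCFields.IsLInfty, MCFields.isSymm_iff_forall_at,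
        MCFields.IsCyclicOps, forall_and]
      tauto
  -- Beyond vanishing in arity zero, which is treated separately, membership in `𝔞(V)` imposes
  -- nothing.
  · refine (MCFields.mem_bigMC_ass_iff A S.shift _ (fun i f => True)
      (fun i ζ => ?_) ξ).trans ?_
    · rw [MCFields.forall_mem_assFields_iff, and_true]
    · simp only [Set.mem_ofPred_eq, MCFields.IsAInfty, and_assoc, implies_true, true_and]
  · refine (MCFields.mem_bigMC_ass_iff A S.shift _ (fun i f =>
      ∀ n, MCFields.IsCyclic S.shift (fun y =>
        (TensorProduct.rid k (A.Alg i)).toLinearMap ∘ₗ (β.omega.flip y).lTensor (A.Alg i)) (f n))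
      (fun i ζ => ?_) ξ).trans ?_
    · simp only [Submodule.mem_inf, forall_and]
      rw [MCFields.forall_mem_assFields_iff, MCFields.forall_mem_sympFields_iff]
    · simp only [Set.mem_ofPred_eq, MCFields.IsAInfty, MCFields.IsCyclicOps]
      tauto
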